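/- Let $\mathbb{T}_1,\mathbb{T}_2$ be time scales (nonempty closed subsets of $\mathbb{R}$), each containing $0$ and some positive number, and put $S_i=[0,\infty)\cap\mathbb{T}_i$, regarded as a time scale with forward jump operator $\sigma_i$, delta derivative $\Delta_i$ and set $S_i^\kappa$ ($S_i$ without its left-scattered maximum, if it has one; otherwise $S_i$). Delta integrals are Cauchy integrals, $\int_\alpha^\beta f\,\Delta t=F(\beta)-F(\alpha)$ with $F$ a pre-antiderivative of $f$. Superscripts $\Delta_i$ denote (partial) delta derivatives, and functions of class $C^k$ are those whose (partial) delta derivatives up to order $k$ exist and are continuous on their natural domains. For a function $p$ of $t_1$ and $t_2$, with $t_2$ fixed, $e_p(\cdot,0)$ denotes the solution on $S_1$ of $x^{\Delta_1}(t_1)=p(t_1,t_2)\,x(t_1)$ for $t_1\in S_1^\kappa$, with $x(0)=1$. Let $u\in C^2(S_1\times S_2)$ satisfy $u(0,t_2)=u(t_1,0)=0$ for $(t_1,t_2)\in S_1\times S_2$ and $u_{t_1t_2}^{\Delta_1\Delta_2}\ge 0$ on $S_1^\kappa\times S_2^\kappa$. Let $c:S_1\times S_2\to[0,\infty)$ be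 continuous. Let $a\in C^1(S_1)$ and $b\in C^1(S_2)$ be positive functions with $a^{\Delta_1}\ge0$ on $S_1^\kappa$ and $b^{\Delta_2}\ge 0$ on $S_2^\kappa$. Suppose that $$u_{t_1t_2}^{\Delta_1\Delta_2}(t_1,t_2)\le a(t_1)+b(t_2)+\int_0^{t_1}\int_0^{t_2}c(s_1,s_2)\left(u(s_1,s_2)+u_{t_1t_2}^{\Delta_1\Delta_2}(s_1,s_2)\right)\Delta_2s_2\,\Delta_1s_1$$ for all $(t_1,t_2)\in S_1^\kappa\times S_2^\kappa$. Then $$u(t_1,t_2)\le\int_0^{t_1}\int_0^{t_2}h(s_1,s_2)\,\Delta_2s_2\,\Delta_1s_1\qquad\text{for all }(t_1,t_2)\in S_1\times S_2,$$ where $$p(t_1,t_2)=\frac{a^{\Delta_1}(t_1)}{a(t_1)+b(0)}+\int_0^{t_2}\bigl(1+c(t_1,s_2)\bigr)\Delta_2s_2\qquad(t_1\in S_1^\kappa,\ t_2\in S_2),$$ $$q(t_1,t_2)=\bigl(a(0)+b(t_2)\bigr)\,e_p(t_1,0)\,c(t_1,t_2)\qquad((t_1,t_2)\in S_1\times S_2),$$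 $$h(t_1,t_2)=a(t_1)+b(t_2)+\int_0^{t_1}\int_0^{t_2}q(s_1,s_2)\,\Delta_2s_2\,\Delta_1s_1\qquad((t_1,t_2)\in S_1\times S_2).$$ -/

import Mathlib

open Set

noncomputable section

namespace TimeScale

/-- A time scale is a nonempty closed subset of the real line. -/
def IsTimeScale (T : Set ℝ) : Prop := T.Nonempty ∧ IsClosed T

open Classical in
/-- Forward jump operator `σ(t) = inf {s ∈ T : s > t}`, with the convention `inf ∅ = sup T`. -/
def sigma (T : Set ℝ) (t : ℝ) : ℝ :=
  if {s ∈ T | t < s}.Nonempty then sInf {s ∈ T | t < s} else sSup T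

open Classical in
/-- Backward jump operator `ρ(t) = sup {s ∈ T : s < t}`, with the convention `sup ∅ = inf T`. -/
def rho (T : Set ℝ) (t : ℝ) : ℝ :=
  if {s ∈ T | s < t}.Nonempty then sSup {s ∈ T | s < t} else sInf T

/-- The set `T^κ`: `T` without `(ρ(sup T), sup T]` if `sup T < ∞`, and `T` otherwise. -/
def kappa (T : Set ℝ) : Set ℝ :=
  {t ∈ T | BddAbove T → t ∉ Ioc (rho T (sSup T)) (sSup T)}

/-- The number `L` is a delta (Hilger) derivative of `f` at `t`, on the time scale `T`. -/
def HasDeltaDerivAt (T : Set ℝ) (f : ℝ → ℝ) (L t : ℝ) : Prop :=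
  ∀ ε > 0, ∃ δ > 0, ∀ s ∈ Ioo (t - δ) (t + δ) ∩ T,
    |f (sigma T t) - f s - L * (sigma T t - s)| ≤ ε * |sigma T t - s|

/-- `f` is delta differentiable at `t`. -/
def DeltaDifferentiableAt (T : Set ℝ) (f : ℝ → ℝ) (t : ℝ) : Prop :=
  ∃ L, HasDeltaDerivAt T f L t

open Classical in
/-- The delta derivative `f^Δ(t)` (and `0` where `f` is not delta differentiable). -/
def deltaDeriv (T : Set ℝ) (f : ℝ → ℝ) (t : ℝ) : ℝ :=
  if h : ∃ L, HasDeltaDerivAt T f L t then h.choose else 0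

/-- `F` is a pre-antiderivative of `f` on `T`: it is continuous on `T` and `F^Δ = f` on a set
`D ⊆ T^κ` such that `T^κ \ D` is countable and contains no right-scattered point. -/
def IsPreAntideriv (T : Set ℝ) (f F : ℝ → ℝ) : Prop :=
  ContinuousOn F T ∧ ∃ D ⊆ kappa T, (kappa T \ D).Countable ∧
    (∀ t ∈ kappa T \ D, ¬ t < sigma T t) ∧ ∀ t ∈ D, HasDeltaDerivAt T F (f t) t

open Classical in
/-- The Cauchy delta integral `∫_a^b f(t) Δt = F(b) - F(a)`, `F` a pre-antiderivative of `f`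
on `T` (and `0` if there is none). -/
def deltaIntegral (T : Set ℝ) (f : ℝ → ℝ) (a b : ℝ) : ℝ :=
  if h : ∃ F, IsPreAntideriv T f F then h.choose b - h.choose a else 0

/-- `x` solves `x^Δ = p(t) x`, `x(t₀) = 1` on `T`. -/
def IsExpSolution (T : Set ℝ) (p : ℝ → ℝ) (t₀ : ℝ) (x : ℝ → ℝ) : Prop :=
  x t₀ = 1 ∧ ∀ t ∈ kappa T, HasDeltaDerivAt T x (p t * x t) t

open Classical in
/-- The exponential function `e_p(t, t₀)` of the time scale `T`: the value at `t` of the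
solution of `x^Δ = p(t) x`, `x(t₀) = 1` (and `0` if there is no solution). -/
def deltaExp (T : Set ℝ) (p : ℝ → ℝ) (t t₀ : ℝ) : ℝ :=
  if h : ∃ x, IsExpSolution T p t₀ x then h.choose t else 0

/-- `f ∈ C¹(T)`: delta differentiable on `T^κ`, with continuous delta derivative. -/
def IsC1 (T : Set ℝ) (f : ℝ → ℝ) : Prop :=
  ContinuousOn f T ∧ (∀ t ∈ kappa T, DeltaDifferentiableAt T f t) ∧
    ContinuousOn (deltaDeriv T f) (kappa T)

/-- Partial delta derivative with respect to the first variable, which runs over `T₁`. -/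
def partialDelta₁ (T₁ : Set ℝ) (f : ℝ → ℝ → ℝ) (t₁ t₂ : ℝ) : ℝ :=
  deltaDeriv T₁ (fun s₁ => f s₁ t₂) t₁

/-- Partial delta derivative with respect to the second variable, which runs over `T₂`. -/
def partialDelta₂ (T₂ : Set ℝ) (f : ℝ → ℝ → ℝ) (t₁ t₂ : ℝ) : ℝ :=
  deltaDeriv T₂ (fun s₂ => f t₁ s₂) t₂

/-- The mixed derivative `f_{t₁t₂}^{Δ₁Δ₂} = (f_{t₁}^{Δ₁})_{t₂}^{Δ₂}`. -/
def partialDelta₁₂ (T₁ T₂ : Set ℝ) (f : ℝ → ℝ → ℝ) : ℝ → ℝ → ℝ :=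
  partialDelta₂ T₂ (partialDelta₁ T₁ f)

/-- `f ∈ C(A × B)`. -/
def IsC0Two (A B : Set ℝ) (f : ℝ → ℝ → ℝ) : Prop :=
  ContinuousOn (fun t : ℝ × ℝ => f t.1 t.2) (A ×ˢ B)

/-- `f ∈ C¹(T₁ × T₂)`: `f` is continuous, and its partial delta derivatives exist and are
continuous on `T₁^κ × T₂` and `T₁ × T₂^κ` respectively. -/
def IsC1Two (T₁ T₂ : Set ℝ) (f : ℝ → ℝ → ℝ) : Prop :=
  IsC0Two T₁ T₂ f ∧
  (∀ t₁ ∈ kappa T₁, ∀ t₂ ∈ T₂, DeltaDifferentiableAt T₁ (fun s₁ => f s₁ t₂) t₁) ∧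
  IsC0Two (kappa T₁) T₂ (partialDelta₁ T₁ f) ∧
  (∀ t₁ ∈ T₁, ∀ t₂ ∈ kappa T₂, DeltaDifferentiableAt T₂ (fun s₂ => f t₁ s₂) t₂) ∧
  IsC0Two T₁ (kappa T₂) (partialDelta₂ T₂ f)

/-- `f ∈ C²(T₁ × T₂)`: `f` is `C¹`, and so are its first partial delta derivatives on their
domains `T₁^κ × T₂` and `T₁ × T₂^κ`. -/
def IsC2Two (T₁ T₂ : Set ℝ) (f : ℝ → ℝ → ℝ) : Prop :=
  IsC1Two T₁ T₂ f ∧ IsC1Two (kappa T₁) T₂ (partialDelta₁ T₁ f) ∧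
    IsC1Two T₁ (kappa T₂) (partialDelta₂ T₂ f)

/-- The iterated integral `∫_0^{t₁} ∫_0^{t₂} f(s₁, s₂) Δ₂s₂ Δ₁s₁`. -/
def deltaIntegral₂ (T₁ T₂ : Set ℝ) (f : ℝ → ℝ → ℝ) (t₁ t₂ : ℝ) : ℝ :=
  deltaIntegral T₁ (fun s₁ => deltaIntegral T₂ (fun s₂ => f s₁ s₂) 0 t₂) 0 t₁

/-- The part `ℝ₊ ∩ T` of a time scale, `ℝ₊ = [0, ∞)`; it is again a time scale if `0 ∈ T`. -/
def nonnegPart (T : Set ℝ) : Set ℝ := Ici 0 ∩ T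

end TimeScale

end

/-! The function `u` is recovered from its mixed delta derivative `W` as an iterated integral, so an
upper bound for `W` suffices. Write `z = a + b + ∫∫ c (u + W)` for the right side of the hypothesis
and `v = z + ∫∫ z`. Then `W ≤ z`, hence `u ≤ ∫∫ z` and `u + W ≤ v`. The mixed derivative of `v` is
`c (u + W) + z ≤ (1 + c) v`; integrating it in the second variable, in which `v` is nondecreasing,
and using `a + b(0) ≤ v` to absorb the boundary term `a^Δ`, one gets `v^Δ₁ ≤ p v` with
`v(0, t₂) = a(0) + b(t₂)`. So `v ≤ (a(0) + b(t₂)) e_p`, and substituting this into `z` yields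
`z ≤ h` and `u ≤ ∫∫ h`. This is `IsHalfScale.prim₂_le_of_le_add_prim₂`.

The delta calculus behind it rests on the map `floorMap S`, which sends `s ≥ 0` to the largest
element of `S` not exceeding it: for `f` continuous, the Lebesgue integral of `f ∘ floorMap S` over
`[0, t]` is a delta antiderivative of `f` (`IsHalfScale.hasDeltaDerivAt_prim`), and every other
pre-antiderivative differs from it by a constant (`IsHalfScale.eq_of_isPreAntideriv_zero`). Cauchy
delta integrals thus become Lebesgue integrals, which are monotone in the integrand and jointly
continuous in parameters. A Picard series gives the exponential function together with its
continuous dependence on the parameter (`IsHalfScale.exists_exp`), without which `q` and `h` might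
fail to be integrable.

Delta integrals only see the integrand on `S^κ`, a closed set. All data are therefore replaced by
Tietze extensions to the plane, and the analysis is done with globally continuous functions. -/

namespace TimeScale

open Filter Topology MeasureTheory intervalIntegral

noncomputable section

/-! ### Half-line time scales and the floor map -/

/-- A time scale `S ⊆ [0, ∞)` that contains `0` and some positive number. -/
structure IsHalfScale (S : Set ℝ) : Prop where
  closed : IsClosed S
  zero_mem : (0 : ℝ) ∈ S
  nonneg : ∀ t ∈ S, 0 ≤ t
  exists_pos : ∃ t ∈ S, 0 < t

/-- The largest element of `S` that is at most `s`. For `s < 0` and `S ⊆ [0, ∞)` the supremum is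
over the empty set, and the value is `0`, which lies in `S` for the sets considered here. -/
def floorMap (S : Set ℝ) (s : ℝ) : ℝ := sSup (S ∩ Iic s)

/-- The least element of `S` that is at least `s`, if there is one. -/
def ceilMap (S : Set ℝ) (s : ℝ) : ℝ := sInf (S ∩ Ici s)

/-- The delta primitive of `f` vanishing at `0`: the Lebesgue integral of `f ∘ floorMap S`. -/
def prim (S : Set ℝ) (f : ℝ → ℝ) (t : ℝ) : ℝ := ∫ s in (0 : ℝ)..t, f (floorMap S s)

theorem le_floorMap {S : Set ℝ} {t s : ℝ} (ht : t ∈ S) (h : t ≤ s) : t ≤ floorMap S s :=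
  le_csSup ⟨s, fun _ hx => hx.2⟩ ⟨ht, h⟩

theorem mem_kappa_of_lt {S : Set ℝ} {s t : ℝ} (hs : s ∈ S) (ht : t ∈ S) (hst : s < t) :
    s ∈ kappa S := by
  refine ⟨hs, fun hb hmem => ?_⟩
  have htM : t ≤ sSup S := le_csSup hb ht
  have hne : {x ∈ S | x < sSup S}.Nonempty := ⟨s, hs, hst.trans_le htM⟩
  have : s ≤ rho S (sSup S) := by
    rw [rho, if_pos hne]
    exact le_csSup ⟨sSup S, fun _ hx => hx.2.le⟩ ⟨hs, hst.trans_le htM⟩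
  exact absurd hmem.1 (not_lt.2 this)

theorem kappa_subset {S : Set ℝ} : kappa S ⊆ S := fun _ h => h.1

theorem le_sigma {S : Set ℝ} {t : ℝ} (ht : t ∈ S) : t ≤ sigma S t := by
  rw [sigma]
  split_ifs with h
  · exact le_csInf h fun x hx => hx.2.le
  · refine le_csSup ⟨t, fun x hx => ?_⟩ ht
    by_contra! hlt
    exact h ⟨x, hx, hlt⟩

theorem sigma_le {S : Set ℝ} {t s : ℝ} (hs : s ∈ S) (h : t < s) : sigma S t ≤ s := by
  rw [sigma, if_pos ⟨s, hs, h⟩]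
  exact csInf_le ⟨t, fun x hx => hx.2.le⟩ ⟨hs, h⟩

theorem countable_scattered {S : Set ℝ} : {t ∈ S | t < sigma S t}.Countable := by
  refine Set.PairwiseDisjoint.countable_of_Ioo (y := sigma S) ?_ fun x hx => hx.2
  intro x hx y hy hxy
  refine Set.disjoint_left.2 fun z hz hz' => ?_
  rcases lt_or_gt_of_ne hxy with h | h
  · linarith [sigma_le hy.1 h, hz.2, hz'.1]
  · linarith [sigma_le hx.1 h, hz.1, hz'.2]

theorem prim_const_mul {S : Set ℝ} (k : ℝ) (f : ℝ → ℝ) (t : ℝ) :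
    prim S (fun s => k * f s) t = k * prim S f t :=
  intervalIntegral.integral_const_mul _ _

@[simp]
theorem prim_zero_right {S : Set ℝ} (f : ℝ → ℝ) : prim S f 0 = 0 := integral_same

namespace IsHalfScale

variable {S : Set ℝ} (hS : IsHalfScale S)
include hS

theorem floorMap_of_neg {s : ℝ} (hs : s < 0) : floorMap S s = 0 := by
  have : S ∩ Iic s = ∅ := by
    ext x
    simp only [mem_inter_iff, mem_Iic, mem_empty_iff_false, iff_false, not_and, not_le]
    intro hx
    linarith [hS.nonneg x hx]
  simp [floorMap, this]

theorem floorMap_mem_inter {s : ℝ} (hs : 0 ≤ s) : floorMap S s ∈ S ∩ Iic s :=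
  (hS.closed.inter isClosed_Iic).csSup_mem ⟨0, hS.zero_mem, hs⟩ ⟨s, fun _ hx => hx.2⟩

theorem floorMap_mem (s : ℝ) : floorMap S s ∈ S := by
  rcases lt_or_ge s 0 with h | h
  · rw [hS.floorMap_of_neg h]; exact hS.zero_mem
  · exact (hS.floorMap_mem_inter h).1

theorem floorMap_le {s : ℝ} (hs : 0 ≤ s) : floorMap S s ≤ s := (hS.floorMap_mem_inter hs).2

theorem floorMap_nonneg (s : ℝ) : 0 ≤ floorMap S s := hS.nonneg _ (hS.floorMap_mem s)

theorem floorMap_of_mem {t : ℝ} (ht : t ∈ S) : floorMap S t = t :=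
  le_antisymm (hS.floorMap_le (hS.nonneg t ht)) (le_floorMap ht le_rfl)

theorem floorMap_le_abs (s : ℝ) : floorMap S s ≤ |s| := by
  rcases lt_or_ge s 0 with h | h
  · rw [hS.floorMap_of_neg h]; exact abs_nonneg s
  · exact (hS.floorMap_le h).trans (le_abs_self s)

theorem floorMap_mono : Monotone (floorMap S) := by
  intro s t hst
  rcases lt_or_ge s 0 with h | h
  · rw [hS.floorMap_of_neg h]; exact hS.floorMap_nonneg t
  · exact le_floorMap (hS.floorMap_mem s) ((hS.floorMap_le h).trans hst)

theorem measurable_floorMap : Measurable (floorMap S) := hS.floorMap_mono.measurable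

theorem floorMap_mem_kappa {s t : ℝ} (hs : 0 ≤ s) (ht : t ∈ S) (hst : s < t) :
    floorMap S s ∈ kappa S :=
  mem_kappa_of_lt (hS.floorMap_mem s) ht ((hS.floorMap_le hs).trans_lt hst)

theorem isClosed_kappa : IsClosed (kappa S) := by
  by_cases hb : BddAbove S
  · have : kappa S = S ∩ Iic (rho S (sSup S)) := by
      ext t
      simp only [kappa, mem_ofPred_eq, mem_inter_iff, mem_Iic, mem_Ioc, not_and, not_le]
      refine and_congr_right fun ht => ⟨fun h => ?_, fun h _ h' => absurd h' (not_lt.2 h)⟩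
      by_contra! hlt
      exact absurd (h hb hlt) (not_lt.2 (le_csSup hb ht))
    rw [this]
    exact hS.closed.inter isClosed_Iic
  · have : kappa S = S := by
      ext t; simp [kappa, hb]
    rw [this]; exact hS.closed

theorem floorMap_eq_of_lt_sigma {t r : ℝ} (ht : t ∈ S) (h1 : t ≤ r) (h2 : r < sigma S t) :
    floorMap S r = t := by
  refine le_antisymm ?_ (le_floorMap ht h1)
  by_contra! hlt
  have := sigma_le (hS.floorMap_mem r) hlt
  linarith [hS.floorMap_le ((hS.nonneg t ht).trans h1)]

/-! ### Primitives of continuous functions -/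

theorem measurable_comp {f : ℝ → ℝ} (hf : Continuous f) : Measurable fun s => f (floorMap S s) :=
  hf.measurable.comp hS.measurable_floorMap

theorem intervalIntegrable {f : ℝ → ℝ} (hf : Continuous f) (a b : ℝ) :
    IntervalIntegrable (fun s => f (floorMap S s)) volume a b := by
  obtain ⟨C, hC⟩ := (isCompact_Icc (a := 0) (b := max |a| |b|)).exists_bound_of_continuousOn
    hf.continuousOn
  refine (intervalIntegrable_const (c := C)).mono_fun
    (hS.measurable_comp hf).aestronglyMeasurable ?_
  refine (ae_restrict_iff' measurableSet_uIoc).2 (Eventually.of_forall fun s hs => ?_)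
  refine (hC _ ⟨hS.floorMap_nonneg s, (hS.floorMap_le_abs s).trans ?_⟩).trans (le_abs_self C)
  rw [uIoc, mem_Ioc] at hs
  rcases le_total a b with h | h
  · rw [min_eq_left h, max_eq_right h] at hs
    rcases abs_cases s with ⟨e, _⟩ | ⟨e, _⟩ <;> rw [e]
    · exact le_max_of_le_right (hs.2.trans (le_abs_self b))
    · exact le_max_of_le_left (by linarith [neg_abs_le a])
  · rw [min_eq_right h, max_eq_left h] at hs
    rcases abs_cases s with ⟨e, _⟩ | ⟨e, _⟩ <;> rw [e]
    · exact le_max_of_le_left (hs.2.trans (le_abs_self a))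
    · exact le_max_of_le_right (by linarith [neg_abs_le b])

theorem prim_mono {f g : ℝ → ℝ} (hf : Continuous f) (hg : Continuous g) {t : ℝ} (ht : t ∈ S)
    (h : ∀ s ∈ kappa S, s ≤ t → f s ≤ g s) : prim S f t ≤ prim S g t := by
  refine integral_mono_on_of_le_Ioo (hS.nonneg t ht) (hS.intervalIntegrable hf _ _)
    (hS.intervalIntegrable hg _ _) fun s hs => ?_
  exact h _ (hS.floorMap_mem_kappa hs.1.le ht hs.2) ((hS.floorMap_le hs.1.le).trans hs.2.le)

theorem prim_nonneg {f : ℝ → ℝ} (hf : Continuous f) {t : ℝ} (ht : t ∈ S)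
    (h : ∀ s ∈ kappa S, 0 ≤ f s) : 0 ≤ prim S f t := by
  have := hS.prim_mono continuous_const hf ht fun s hs _ => h s hs
  simpa [prim] using this

theorem prim_le_prim {f : ℝ → ℝ} (hf : Continuous f) {s t : ℝ} (hs : s ∈ S) (ht : t ∈ S)
    (hst : s ≤ t) (h : ∀ s ∈ kappa S, 0 ≤ f s) : prim S f s ≤ prim S f t := by
  rw [prim, prim, ← integral_add_adjacent_intervals (hS.intervalIntegrable hf 0 s)
    (hS.intervalIntegrable hf s t)]
  refine le_add_of_nonneg_right ?_
  rw [← integral_zero (a := s) (b := t) (E := ℝ) (μ := volume)]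
  refine integral_mono_on_of_le_Ioo hst (by simp) (hS.intervalIntegrable hf _ _) fun r hr => ?_
  exact h _ (hS.floorMap_mem_kappa ((hS.nonneg s hs).trans hr.1.le) ht hr.2)

theorem prim_add {f g : ℝ → ℝ} (hf : Continuous f) (hg : Continuous g) (t : ℝ) :
    prim S (fun s => f s + g s) t = prim S f t + prim S g t :=
  integral_add (hS.intervalIntegrable hf 0 t) (hS.intervalIntegrable hg 0 t)

theorem prim_sub {f g : ℝ → ℝ} (hf : Continuous f) (hg : Continuous g) (t : ℝ) :
    prim S (fun s => f s - g s) t = prim S f t - prim S g t :=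
  integral_sub (hS.intervalIntegrable hf 0 t) (hS.intervalIntegrable hg 0 t)

/-- A primitive of a family of continuous functions is jointly continuous in the parameter and
the upper limit. -/
theorem continuous_prim {X : Type*} [TopologicalSpace X] [FirstCountableTopology X]
    [LocallyCompactSpace X] {f : X → ℝ → ℝ} (hf : Continuous fun z : X × ℝ => f z.1 z.2) :
    Continuous fun z : X × ℝ => prim S (f z.1) z.2 := by
  refine continuous_iff_continuousAt.2 fun ⟨x₀, t₀⟩ => ?_
  obtain ⟨K, hK, hKx⟩ := exists_compact_mem_nhds x₀
  obtain ⟨C, hC⟩ := (hK.prod (isCompact_Icc (a := 0) (b := |t₀| + 1))).exists_bound_of_continuousOn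
    hf.continuousOn
  have hfx : ∀ x, Continuous (f x) := fun x =>
    hf.comp (by fun_prop : Continuous fun s : ℝ => (x, s))
  refine continuousAt_parametric_primitive_of_dominated (fun _ => C) (-(|t₀| + 1)) (|t₀| + 1)
    (fun x => (hS.measurable_comp (hfx x)).aestronglyMeasurable) ?_ intervalIntegrable_const
    (Eventually.of_forall fun s => ?_) ?_ ?_ (by simp)
  · filter_upwards [hKx] with x hx
    refine (ae_restrict_iff' measurableSet_uIoc).2 (Eventually.of_forall fun s hs => ?_)
    refine hC (x, floorMap S s) ⟨hx, hS.floorMap_nonneg s, (hS.floorMap_le_abs s).trans ?_⟩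
    rw [uIoc_of_le (by linarith [abs_nonneg t₀])] at hs
    exact abs_le.2 ⟨hs.1.le, hs.2⟩
  · exact (hf.comp (by fun_prop : Continuous fun x : X => (x, floorMap S s))).continuousAt
  · constructor <;> linarith [abs_nonneg t₀]
  · constructor <;> linarith [le_abs_self t₀, neg_abs_le t₀]

theorem continuous_prim' {f : ℝ → ℝ} (hf : Continuous f) : Continuous (prim S f) :=
  (hS.continuous_prim (X := Unit) (f := fun _ => f) (hf.comp continuous_snd)).comp
    (by fun_prop : Continuous fun t : ℝ => ((), t))

theorem hasDeltaDerivAt_prim {f : ℝ → ℝ} (hf : Continuous f) {t : ℝ} (ht : t ∈ S) :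
    HasDeltaDerivAt S (prim S f) (f t) t := by
  intro ε hε
  obtain ⟨δ, hδ, hfδ⟩ := Metric.continuousAt_iff.1 hf.continuousAt ε hε
  refine ⟨δ, hδ, fun s ⟨hs, hsS⟩ => ?_⟩
  have key : prim S f (sigma S t) - prim S f s - f t * (sigma S t - s)
      = ∫ r in s..sigma S t, (f (floorMap S r) - f t) := by
    rw [integral_sub (hS.intervalIntegrable hf _ _) (by simp), prim, prim,
      integral_interval_sub_left (hS.intervalIntegrable hf _ _) (hS.intervalIntegrable hf _ _)]
    simp [mul_comm]
  rw [key]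
  refine norm_integral_le_of_norm_le_const_ae (E := ℝ) ?_
  have hne : ∀ᵐ r : ℝ, r ≠ sigma S t := by simp [ae_iff, measure_singleton]
  filter_upwards [hne] with r hrne hr
  have hle := le_sigma ht
  have hclose : |floorMap S r - t| < δ := by
    rcases le_or_gt t r with h | h
    · rcases lt_or_gt_of_ne hrne with h' | h'
      · rw [hS.floorMap_eq_of_lt_sigma ht h h']; simpa using hδ
      · have h1 : r ≤ s := by
          rcases le_total s (sigma S t) with h2 | h2
          · rw [uIoc_of_le h2] at hr; linarith [hr.2]
          · rw [uIoc_of_ge h2] at hr; exact hr.2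
        have h3 := le_floorMap ht h
        have h4 := hS.floorMap_le ((hS.nonneg t ht).trans h)
        rw [abs_of_nonneg (by linarith)]
        linarith [hs.2]
    · have h1 : s ≤ r := by
        rcases le_total s (sigma S t) with h2 | h2
        · rw [uIoc_of_le h2] at hr; exact hr.1.le
        · rw [uIoc_of_ge h2] at hr; linarith [hr.1]
      have h3 := le_floorMap hsS h1
      have h4 := hS.floorMap_le ((hS.nonneg s hsS).trans h1)
      rw [abs_of_nonpos (by linarith)]
      linarith [hs.1]
  exact (hfδ (by simpa [Real.dist_eq] using hclose)).le

theorem isPreAntideriv_prim {f g : ℝ → ℝ} (hg : Continuous g) (h : ∀ t ∈ kappa S, f t = g t) :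
    IsPreAntideriv S f (prim S g) :=
  ⟨(hS.continuous_prim' hg).continuousOn, kappa S, Subset.rfl, by simp, by simp,
    fun t ht => h t ht ▸ hS.hasDeltaDerivAt_prim hg (kappa_subset ht)⟩

end IsHalfScale

/-! ### Delta derivatives: jumps, uniqueness, continuity -/

theorem HasDeltaDerivAt.sub {S : Set ℝ} {f g : ℝ → ℝ} {L M t : ℝ} (hf : HasDeltaDerivAt S f L t)
    (hg : HasDeltaDerivAt S g M t) : HasDeltaDerivAt S (fun s => f s - g s) (L - M) t := by
  intro ε hε
  obtain ⟨δ₁, h₁, hf⟩ := hf (ε / 2) (by positivity)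
  obtain ⟨δ₂, h₂, hg⟩ := hg (ε / 2) (by positivity)
  refine ⟨min δ₁ δ₂, lt_min h₁ h₂, fun s ⟨hs, hsS⟩ => ?_⟩
  have hf := hf s ⟨⟨by linarith [hs.1, min_le_left δ₁ δ₂], by linarith [hs.2, min_le_left δ₁ δ₂]⟩,
    hsS⟩
  have hg := hg s ⟨⟨by linarith [hs.1, min_le_right δ₁ δ₂], by linarith [hs.2, min_le_right δ₁ δ₂]⟩,
    hsS⟩
  have := abs_sub (f (sigma S t) - f s - L * (sigma S t - s))
    (g (sigma S t) - g s - M * (sigma S t - s))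
  calc _ = |f (sigma S t) - f s - L * (sigma S t - s)
            - (g (sigma S t) - g s - M * (sigma S t - s))| := by congr 1; ring
    _ ≤ ε * |sigma S t - s| := by linarith

theorem HasDeltaDerivAt.apply_sigma {S : Set ℝ} {f : ℝ → ℝ} {L t : ℝ}
    (hf : HasDeltaDerivAt S f L t) (ht : t ∈ S) :
    f (sigma S t) = f t + L * (sigma S t - t) := by
  have h : ∀ ε > 0, |f (sigma S t) - f t - L * (sigma S t - t)| ≤ ε * |sigma S t - t| := by
    intro ε hε
    obtain ⟨δ, hδ, h⟩ := hf ε hε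
    exact h t ⟨⟨by linarith, by linarith⟩, ht⟩
  have h0 : |f (sigma S t) - f t - L * (sigma S t - t)| ≤ 0 := by
    refine le_of_forall_pos_le_add fun η hη => ?_
    have hd : 0 < |sigma S t - t| + 1 := by positivity
    refine (h (η / (|sigma S t - t| + 1)) (by positivity)).trans ?_
    rw [div_mul_eq_mul_div, div_le_iff₀ hd]
    nlinarith [abs_nonneg (sigma S t - t)]
  linarith [abs_nonpos_iff.1 h0]

theorem HasDeltaDerivAt.continuousWithinAt {S : Set ℝ} {f : ℝ → ℝ} {L t : ℝ}
    (hf : HasDeltaDerivAt S f L t) (ht : t ∈ S) : ContinuousWithinAt f S t := by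
  rw [Metric.continuousWithinAt_iff]
  intro ε hε
  have hj := hf.apply_sigma ht
  set m := |sigma S t - t| with hm
  have hm0 : 0 ≤ m := abs_nonneg _
  obtain ⟨δ, hδ, h⟩ := hf (ε / (2 * (m + 1))) (by positivity)
  refine ⟨min (min δ 1) (ε / (2 * (|L| + 1))), by positivity, fun s hs hd => ?_⟩
  rw [Real.dist_eq] at hd ⊢
  have h1 : |s - t| < δ := hd.trans_le ((min_le_left _ _).trans (min_le_left _ _))
  have h2 : |s - t| < 1 := hd.trans_le ((min_le_left _ _).trans (min_le_right _ _))
  have h3 : |s - t| < ε / (2 * (|L| + 1)) := hd.trans_le (min_le_right _ _)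
  have h4 := h s ⟨⟨by linarith [(abs_lt.1 h1).1], by linarith [(abs_lt.1 h1).2]⟩, hs⟩
  have h5 : |sigma S t - s| ≤ m + 1 := by
    have := abs_sub_le (sigma S t) t s
    rw [abs_sub_comm t s] at this
    linarith
  have h6 : ε / (2 * (m + 1)) * |sigma S t - s| ≤ ε / 2 := by
    calc _ ≤ ε / (2 * (m + 1)) * (m + 1) := by gcongr
      _ = ε / 2 := by field_simp
  have h7 : |L * (s - t)| < ε / 2 := by
    rw [abs_mul]
    rw [lt_div_iff₀ (by positivity)] at h3
    nlinarith [abs_nonneg (s - t), abs_nonneg L]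
  have h8 : f s - f t = L * (s - t) - (f (sigma S t) - f s - L * (sigma S t - s)) := by
    rw [hj]; ring
  rw [h8]
  calc _ ≤ |L * (s - t)| + |f (sigma S t) - f s - L * (sigma S t - s)| := abs_sub _ _
    _ < ε := by linarith

namespace IsHalfScale

variable {S : Set ℝ} (hS : IsHalfScale S)
include hS

/-- Every point `t` of `S^κ` has points of `S` other than `σ(t)` arbitrarily close to it; this is
what makes delta derivatives on `S^κ` unique. -/
theorem exists_ne_sigma {t : ℝ} (ht : t ∈ kappa S) {δ : ℝ} (hδ : 0 < δ) :
    ∃ s ∈ Ioo (t - δ) (t + δ) ∩ S, s ≠ sigma S t := by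
  by_contra! hall
  have htS := ht.1
  have hσ : t = sigma S t := hall t ⟨⟨by linarith, by linarith⟩, htS⟩
  by_cases hne : {s ∈ S | t < s}.Nonempty
  · have : t + δ ≤ sigma S t := by
      rw [sigma, if_pos hne]
      refine le_csInf hne fun x hx => ?_
      by_contra! hlt
      have := hall x ⟨⟨by linarith [hx.2], hlt⟩, hx.1⟩
      linarith [hx.2]
    linarith
  · have hmax : ∀ x ∈ S, x ≤ t := fun x hx => not_lt.1 fun h => hne ⟨x, hx, h⟩
    have hsup : sSup S = t := le_antisymm (csSup_le ⟨t, htS⟩ hmax) (le_csSup ⟨t, hmax⟩ htS)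
    have hnot := ht.2 ⟨t, hmax⟩
    obtain ⟨x, hx, hx0⟩ := hS.exists_pos
    have hne' : {s ∈ S | s < t}.Nonempty := ⟨0, hS.zero_mem, hx0.trans_le (hmax x hx)⟩
    rw [hsup] at hnot
    refine hnot ⟨?_, le_rfl⟩
    rw [rho, if_pos hne']
    have : sSup {s ∈ S | s < t} ≤ t - δ := by
      refine csSup_le hne' fun x hx => ?_
      by_contra! hlt
      have := hall x ⟨⟨hlt, by linarith [hx.2]⟩, hx.1⟩
      linarith [hx.2]
    linarith

theorem eq_zero_of_hasDeltaDerivAt {f : ℝ → ℝ} {L t : ℝ} (ht : t ∈ kappa S)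
    (hf : HasDeltaDerivAt S f L t) (h0 : ∀ s ∈ S, f s = 0) : L = 0 := by
  have h0' : f (sigma S t) = L * (sigma S t - t) := by
    rw [hf.apply_sigma ht.1, h0 t ht.1, zero_add]
  have hσ : f (sigma S t) = 0 := by
    by_cases hne : {s ∈ S | t < s}.Nonempty
    · refine h0 _ ?_
      rw [sigma, if_pos hne]
      have hcl := csInf_mem_closure hne ⟨t, fun x hx => hx.2.le⟩
      exact hS.closed.closure_subset_iff.2 (fun x hx => hx.1) hcl
    · have hmax : ∀ x ∈ S, x ≤ t := fun x hx => not_lt.1 fun h => hne ⟨x, hx, h⟩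
      have hsup : sSup S = t := le_antisymm (csSup_le ⟨t, ht.1⟩ hmax) (le_csSup ⟨t, hmax⟩ ht.1)
      rw [sigma, if_neg hne, hsup, h0 t ht.1]
  refine abs_nonpos_iff.1 (le_of_forall_pos_le_add fun ε hε => ?_)
  obtain ⟨δ, hδ, h⟩ := hf ε hε
  obtain ⟨s, hs, hne⟩ := hS.exists_ne_sigma ht hδ
  have := h s hs
  rw [hσ, h0 s hs.2, sub_zero, zero_sub, abs_neg, abs_mul] at this
  rw [zero_add]
  exact le_of_mul_le_mul_right this (abs_pos.2 (sub_ne_zero.2 hne.symm))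

/-- A function that is delta differentiable on `S^κ` is continuous on all of `S`, because a point
of `S` outside `S^κ` is isolated. -/
theorem continuousOn_of_hasDeltaDerivAt {f g : ℝ → ℝ}
    (hf : ∀ t ∈ kappa S, HasDeltaDerivAt S f (g t) t) : ContinuousOn f S := by
  intro t ht
  by_cases htk : t ∈ kappa S
  · exact (hf t htk).continuousWithinAt ht
  · have hmax : ∀ x ∈ S, x ≤ t := fun x hx =>
      not_lt.1 fun h => htk (mem_kappa_of_lt ht hx h)
    have hsub : S ⊆ kappa S ∪ {t} := fun x hx =>
      (hmax x hx).lt_or_eq.imp (fun h => mem_kappa_of_lt hx ht h) id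
    refine ContinuousWithinAt.mono ?_ hsub
    refine ContinuousWithinAt.union ?_ continuousWithinAt_singleton
    -- `t` is not in the closed set `S^κ`, so continuity within it is vacuous
    have : 𝓝[kappa S] t = ⊥ := by
      rw [← notMem_closure_iff_nhdsWithin_eq_bot, hS.isClosed_kappa.closure_eq]; exact htk
    simp [ContinuousWithinAt, this]

/-! ### Uniqueness of delta primitives -/

theorem ceilMap_spec {s t : ℝ} (ht : t ∈ S) (hst : s ≤ t) :
    ceilMap S s ∈ S ∧ s ≤ ceilMap S s ∧ ceilMap S s ≤ t := by
  have h := (hS.closed.inter isClosed_Ici).csInf_mem (⟨t, ht, hst⟩ : (S ∩ Ici s).Nonempty)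
    ⟨s, fun _ hx => hx.2⟩
  exact ⟨h.1, h.2, csInf_le ⟨s, fun _ hx => hx.2⟩ ⟨ht, hst⟩⟩

/-- Across a gap of `S` a function whose delta derivative vanishes does not change. -/
theorem apply_floorMap_eq_apply_ceilMap {H : ℝ → ℝ} {s t : ℝ} (hs : 0 ≤ s) (ht : t ∈ S)
    (hst : s ≤ t) (hH : ∀ r ∈ kappa S, r < sigma S r → HasDeltaDerivAt S H 0 r) :
    H (floorMap S s) = H (ceilMap S s) := by
  obtain ⟨hcS, hsc, hct⟩ := hS.ceilMap_spec ht hst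
  by_cases hsS : s ∈ S
  · have : ceilMap S s = s := le_antisymm (hS.ceilMap_spec hsS le_rfl).2.2 hsc
    rw [this, hS.floorMap_of_mem hsS]
  · have hfS := hS.floorMap_mem s
    have hfs : floorMap S s < s :=
      lt_of_le_of_ne (hS.floorMap_le hs) fun h => hsS (h ▸ hfS)
    have hne : {x ∈ S | floorMap S s < x}.Nonempty := ⟨_, hcS, hfs.trans_le hsc⟩
    have hge : ∀ x ∈ S, floorMap S s < x → ceilMap S s ≤ x := fun x hx h =>
      csInf_le ⟨s, fun _ hx => hx.2⟩
        ⟨hx, le_of_not_gt fun h' => absurd (le_floorMap hx h'.le) (not_le.2 h)⟩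
    have hσ : sigma S (floorMap S s) = ceilMap S s :=
      le_antisymm (sigma_le hcS (hfs.trans_le hsc))
        (by rw [sigma, if_pos hne]; exact le_csInf hne fun x hx => hge x hx.1 hx.2)
    have hlt : floorMap S s < sigma S (floorMap S s) := by rw [hσ]; exact hfs.trans_le hsc
    have := (hH _ (mem_kappa_of_lt hfS ht (hfs.trans_le hst)) hlt).apply_sigma hfS
    rw [hσ] at this
    simpa using this.symm

/-- The mean value theorem in its simplest case: a pre-antiderivative of `0` is constant. The
function `H ∘ floorMap S` is continuous, since `H` does not change across gaps, and it has
derivative `0` off a countable set. -/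
theorem eq_of_isPreAntideriv_zero {H : ℝ → ℝ} (hH : IsPreAntideriv S (fun _ => 0) H) {t : ℝ}
    (ht : t ∈ S) : H t = H 0 := by
  obtain ⟨hc, D, hD, hcount, hns, hder⟩ := hH
  have hjump : ∀ r ∈ kappa S, r < sigma S r → HasDeltaDerivAt S H 0 r := fun r hr hlt =>
    hder r (by_contra fun h => hns r ⟨hr, h⟩ hlt)
  have hfc : ∀ s, 0 ≤ s → s ≤ t → H (floorMap S s) = H (ceilMap S s) := fun s h0 hst =>
    hS.apply_floorMap_eq_apply_ceilMap h0 ht hst hjump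
  -- near a point `x` of `S`, the value at `s` is taken by `H` at a point of `S` between `x` and `s`
  have hbetween : ∀ x ∈ S, ∀ s, 0 ≤ s → s ≤ t →
      ∃ r ∈ S, |r - x| ≤ |s - x| ∧ H (floorMap S s) = H r := by
    intro x hx s h0 hst
    rcases le_total x s with h | h
    · refine ⟨floorMap S s, hS.floorMap_mem s, ?_, rfl⟩
      have h1 := le_floorMap hx h
      rw [abs_of_nonneg (by linarith), abs_of_nonneg (by linarith)]
      linarith [hS.floorMap_le h0]
    · obtain ⟨h1, h2, h3⟩ := hS.ceilMap_spec hx h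
      refine ⟨ceilMap S s, h1, ?_, hfc s h0 hst⟩
      rw [abs_of_nonpos (by linarith), abs_of_nonpos (by linarith)]
      linarith
  have hconst : ∀ x, 0 < x → x ∉ S → ∀ᶠ s in 𝓝 x, floorMap S s = floorMap S x := by
    intro x hx0 hx
    obtain ⟨δ, hδ, hball⟩ := Metric.isOpen_iff.1 hS.closed.isOpen_compl x hx
    filter_upwards [Metric.ball_mem_nhds x hδ, lt_mem_nhds hx0] with s hs hs0
    rw [floorMap, floorMap]
    congr 1
    ext y
    refine and_congr_right fun hy => ?_
    rw [Metric.mem_ball, Real.dist_eq, abs_lt] at hs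
    have hfar : ¬ (x - δ < y ∧ y < x + δ) := fun h =>
      hball (by rw [Metric.mem_ball, Real.dist_eq, abs_lt]; constructor <;> linarith [h.1, h.2]) hy
    simp only [mem_Iic]
    constructor <;> intro h <;> by_contra! hlt <;> exact hfar ⟨by linarith, by linarith⟩
  have ht0 := hS.nonneg t ht
  have hint := integral_eq_of_hasDerivAt_off_countable_of_le (fun s => H (floorMap S s))
    (fun _ => (0 : ℝ)) ht0 (s := (kappa S \ D) ∪ {x ∈ S | x < sigma S x})
    (hcount.union countable_scattered) ?_ ?_ (by simp)
  · rw [intervalIntegral.integral_zero, hS.floorMap_of_mem ht, hS.floorMap_of_mem hS.zero_mem] at hint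
    linarith
  · intro x hx
    by_cases hxS : x ∈ S
    · rw [Metric.continuousWithinAt_iff]
      intro ε hε
      obtain ⟨δ, hδ, h⟩ := Metric.continuousWithinAt_iff.1 (hc x hxS) ε hε
      refine ⟨δ, hδ, fun s hs hsx => ?_⟩
      obtain ⟨r, hr, hrx, hrs⟩ := hbetween x hxS s hs.1 hs.2
      rw [hrs, hS.floorMap_of_mem hxS]
      exact h hr (hrx.trans_lt hsx)
    · have hx0 : 0 < x := lt_of_le_of_ne hx.1 fun h => hxS (h ▸ hS.zero_mem)
      have : (fun s => H (floorMap S s)) =ᶠ[𝓝 x] fun _ => H (floorMap S x) :=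
        (hconst x hx0 hxS).mono fun s hs => by simp only [hs]
      exact (continuousAt_const.congr this.symm).continuousWithinAt
  · rintro x ⟨hx, hxN⟩
    by_cases hxS : x ∈ S
    · have hxk : x ∈ kappa S := mem_kappa_of_lt hxS ht hx.2
      have hxD : x ∈ D := by_contra fun h => hxN (Or.inl ⟨hxk, h⟩)
      have hσ : sigma S x = x :=
        le_antisymm (not_lt.1 fun h => hxN (Or.inr ⟨hxS, h⟩)) (le_sigma hxS)
      rw [hasDerivAt_iff_isLittleO, Asymptotics.isLittleO_iff]
      intro ε hε
      obtain ⟨δ, hδ, h⟩ := hder x hxD ε hε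
      filter_upwards [Metric.ball_mem_nhds x hδ, Ioo_mem_nhds hx.1 hx.2] with s hs hs'
      obtain ⟨r, hr, hrx, hrs⟩ := hbetween x hxS s hs'.1.le hs'.2.le
      have hrδ : |r - x| < δ := hrx.trans_lt hs
      have := h r ⟨⟨by linarith [(abs_lt.1 hrδ).1], by linarith [(abs_lt.1 hrδ).2]⟩, hr⟩
      rw [hσ, zero_mul, sub_zero, abs_sub_comm, abs_sub_comm x r] at this
      rw [hrs, hS.floorMap_of_mem hxS, smul_zero, sub_zero]
      exact this.trans (mul_le_mul_of_nonneg_left hrx hε.le)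
    · exact (hasDerivAt_const x (H (floorMap S x))).congr_of_eventuallyEq
        ((hconst x hx.1 hxS).mono fun s hs => by simp only [hs])

theorem eq_add_prim_of_isPreAntideriv {f g F : ℝ → ℝ} (hF : IsPreAntideriv S f F)
    (hg : Continuous g) (hfg : ∀ t ∈ kappa S, f t = g t) {t : ℝ} (ht : t ∈ S) :
    F t = F 0 + prim S g t := by
  obtain ⟨hc, D, hD, hcount, hns, hder⟩ := hF
  have := hS.eq_of_isPreAntideriv_zero (H := fun s => F s - prim S g s)
    ⟨hc.sub (hS.continuous_prim' hg).continuousOn, D, hD, hcount, hns, fun s hs => by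
      have := (hder s hs).sub (hS.hasDeltaDerivAt_prim hg (hD hs).1)
      rwa [hfg s (hD hs), sub_self] at this⟩ ht
  simp only [prim_zero_right] at this
  linarith

/-- The fundamental theorem of calculus for functions with continuous delta derivative. -/
theorem eq_add_prim {g F : ℝ → ℝ} (hF : ContinuousOn F S) (hg : Continuous g)
    (h : ∀ t ∈ kappa S, HasDeltaDerivAt S F (g t) t) {t : ℝ} (ht : t ∈ S) :
    F t = F 0 + prim S g t :=
  hS.eq_add_prim_of_isPreAntideriv (f := g) ⟨hF, kappa S, Subset.rfl, by simp, by simp, h⟩ hg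
    (fun _ _ => rfl) ht

theorem deltaIntegral_eq {f g : ℝ → ℝ} (hg : Continuous g) (hfg : ∀ t ∈ kappa S, f t = g t)
    {t : ℝ} (ht : t ∈ S) : deltaIntegral S f 0 t = prim S g t := by
  have hex : ∃ F, IsPreAntideriv S f F := ⟨_, hS.isPreAntideriv_prim hg hfg⟩
  rw [deltaIntegral, dif_pos hex, hS.eq_add_prim_of_isPreAntideriv hex.choose_spec hg hfg ht]
  ring

end IsHalfScale

theorem DeltaDifferentiableAt.hasDeltaDerivAt {S : Set ℝ} {f : ℝ → ℝ} {t : ℝ}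
    (h : DeltaDifferentiableAt S f t) : HasDeltaDerivAt S f (deltaDeriv S f t) t := by
  have h' : ∃ L, HasDeltaDerivAt S f L t := h
  rw [deltaDeriv, dif_pos h']
  exact h'.choose_spec

/-! ### Iterated primitives -/

/-- The iterated delta primitive of a function of two variables. -/
def prim₂ (S₁ S₂ : Set ℝ) (f : ℝ → ℝ → ℝ) (t₁ t₂ : ℝ) : ℝ :=
  prim S₁ (fun s₁ => prim S₂ (f s₁) t₂) t₁

section

variable {S₁ S₂ : Set ℝ} (h₁ : IsHalfScale S₁) (h₂ : IsHalfScale S₂)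
include h₁ h₂

theorem IsHalfScale.continuous_prim₂ {f : ℝ → ℝ → ℝ} (hf : Continuous fun z : ℝ × ℝ => f z.1 z.2) :
    Continuous fun z : ℝ × ℝ => prim₂ S₁ S₂ f z.1 z.2 :=
  (h₁.continuous_prim (f := fun t₂ s₁ => prim S₂ (f s₁) t₂)
    ((h₂.continuous_prim hf).comp continuous_swap)).comp continuous_swap

theorem IsHalfScale.deltaIntegral₂_eq {f g : ℝ → ℝ → ℝ}
    (hg : Continuous fun z : ℝ × ℝ => g z.1 z.2)
    (hfg : ∀ s₁ ∈ kappa S₁, ∀ s₂ ∈ kappa S₂, f s₁ s₂ = g s₁ s₂) {t₁ t₂ : ℝ} (ht₁ : t₁ ∈ S₁)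
    (ht₂ : t₂ ∈ S₂) : deltaIntegral₂ S₁ S₂ f t₁ t₂ = prim₂ S₁ S₂ g t₁ t₂ := by
  refine h₁.deltaIntegral_eq (g := fun s₁ => prim S₂ (g s₁) t₂)
    ((h₂.continuous_prim hg).comp (by fun_prop : Continuous fun s : ℝ => (s, t₂)))
    (fun s₁ hs₁ => ?_) ht₁
  exact h₂.deltaIntegral_eq (hg.comp (by fun_prop : Continuous fun s : ℝ => (s₁, s)))
    (hfg s₁ hs₁) ht₂

theorem IsHalfScale.prim₂_mono {f g : ℝ → ℝ → ℝ} (hf : Continuous fun z : ℝ × ℝ => f z.1 z.2)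
    (hg : Continuous fun z : ℝ × ℝ => g z.1 z.2)
    (hfg : ∀ s₁ ∈ kappa S₁, ∀ s₂ ∈ kappa S₂, f s₁ s₂ ≤ g s₁ s₂) {t₁ t₂ : ℝ} (ht₁ : t₁ ∈ S₁)
    (ht₂ : t₂ ∈ S₂) : prim₂ S₁ S₂ f t₁ t₂ ≤ prim₂ S₁ S₂ g t₁ t₂ := by
  have hc : Continuous fun s : ℝ => (s, t₂) := by fun_prop
  refine h₁.prim_mono ((h₂.continuous_prim hf).comp hc) ((h₂.continuous_prim hg).comp hc) ht₁
    fun s₁ hs₁ _ => ?_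
  have hc' : Continuous fun s : ℝ => (s₁, s) := by fun_prop
  exact h₂.prim_mono (hf.comp hc') (hg.comp hc') ht₂ fun s₂ hs₂ _ => hfg s₁ hs₁ s₂ hs₂

theorem IsHalfScale.prim₂_nonneg {f : ℝ → ℝ → ℝ} (hf : Continuous fun z : ℝ × ℝ => f z.1 z.2)
    (h : ∀ s₁ ∈ kappa S₁, ∀ s₂ ∈ kappa S₂, 0 ≤ f s₁ s₂) {t₁ t₂ : ℝ} (ht₁ : t₁ ∈ S₁)
    (ht₂ : t₂ ∈ S₂) : 0 ≤ prim₂ S₁ S₂ f t₁ t₂ := by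
  refine h₁.prim_nonneg
    ((h₂.continuous_prim hf).comp (by fun_prop : Continuous fun s : ℝ => (s, t₂))) ht₁
    fun s₁ hs₁ => ?_
  exact h₂.prim_nonneg (hf.comp (by fun_prop : Continuous fun s : ℝ => (s₁, s))) ht₂ (h s₁ hs₁)

theorem IsHalfScale.prim₂_le_prim₂ {f : ℝ → ℝ → ℝ} (hf : Continuous fun z : ℝ × ℝ => f z.1 z.2)
    (h : ∀ s₁ ∈ kappa S₁, ∀ s₂ ∈ kappa S₂, 0 ≤ f s₁ s₂) {t₁ s₂ t₂ : ℝ} (ht₁ : t₁ ∈ S₁)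
    (hs₂ : s₂ ∈ S₂) (ht₂ : t₂ ∈ S₂) (hst : s₂ ≤ t₂) :
    prim₂ S₁ S₂ f t₁ s₂ ≤ prim₂ S₁ S₂ f t₁ t₂ := by
  have hc : ∀ r : ℝ, Continuous fun s : ℝ => (s, r) := fun r => by fun_prop
  refine h₁.prim_mono ((h₂.continuous_prim hf).comp (hc s₂))
    ((h₂.continuous_prim hf).comp (hc t₂)) ht₁ fun s₁ hs₁ _ => ?_
  exact h₂.prim_le_prim (hf.comp (by fun_prop : Continuous fun s : ℝ => (s₁, s))) hs₂ ht₂ hst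
    (h s₁ hs₁)

end

/-! ### Grönwall's inequality and the exponential function -/

theorem exists_continuous_eq {X : Type*} [TopologicalSpace X] [NormalSpace X] {A : Set X}
    (hA : IsClosed A) {f : X → ℝ} (hf : ContinuousOn f A) :
    ∃ g : X → ℝ, Continuous g ∧ ∀ x ∈ A, f x = g x := by
  obtain ⟨g, hg⟩ := ContinuousMap.exists_restrict_eq hA ⟨A.domRestrict f, hf.domRestrict⟩
  exact ⟨g, g.continuous, fun x hx => (congr($hg ⟨x, hx⟩)).symm⟩

/-- The Picard iterates of `x ↦ 1 + ∫ p x`, split into the terms of a series: the `n`-th term is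
the `n`-fold iterated delta integral of `p(y, ·)`. -/
def picardTerm (S : Set ℝ) (p : ℝ → ℝ → ℝ) : ℕ → ℝ → ℝ → ℝ
  | 0, _, _ => 1
  | n + 1, y, t => prim S (fun s => p y s * picardTerm S p n y s) t

namespace IsHalfScale

variable {S : Set ℝ} (hS : IsHalfScale S)
include hS

theorem abs_prim_le {f g : ℝ → ℝ} (hg : Continuous g) {t : ℝ} (ht : 0 ≤ t)
    (h : ∀ s ∈ S, s ≤ t → |f s| ≤ g s) : |prim S f t| ≤ prim S g t := by
  refine norm_integral_le_of_norm_le (f := fun s => f (floorMap S s)) ht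
    (Eventually.of_forall fun s hs => ?_)
    (hS.intervalIntegrable hg 0 t)
  exact h _ (hS.floorMap_mem s) ((hS.floorMap_le hs.1.le).trans hs.2)

/-- Against the weight `exp (2Pt)` the operator `f ↦ P ∫ f` is a contraction with factor `1/2`. -/
theorem prim_exp_le {P : ℝ} (hP : 0 < P) {t : ℝ} (ht : 0 ≤ t) :
    prim S (fun s => P * Real.exp (2 * P * s)) t ≤ Real.exp (2 * P * t) / 2 := by
  have hd : ∀ x ∈ uIcc 0 t, HasDerivAt (fun s => Real.exp (2 * P * s) / 2)
      (P * Real.exp (2 * P * x)) x := fun x _ => by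
    have := (((hasDerivAt_id x).const_mul (2 * P)).exp).div_const 2
    refine this.congr_deriv ?_
    simp only [id]; ring
  have hint : ∫ s in (0 : ℝ)..t, P * Real.exp (2 * P * s)
      = Real.exp (2 * P * t) / 2 - Real.exp (2 * P * 0) / 2 :=
    integral_eq_sub_of_hasDerivAt hd (Continuous.intervalIntegrable (by fun_prop) _ _)
  calc prim S (fun s => P * Real.exp (2 * P * s)) t
      ≤ ∫ s in (0 : ℝ)..t, P * Real.exp (2 * P * s) := by
        refine integral_mono_on ht
          (hS.intervalIntegrable (f := fun s => P * Real.exp (2 * P * s)) (by fun_prop) 0 t)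
          (Continuous.intervalIntegrable (by fun_prop) _ _) fun s hs => ?_
        have := hS.floorMap_le hs.1
        beta_reduce
        gcongr
    _ ≤ Real.exp (2 * P * t) / 2 := by
        rw [hint]; linarith [Real.exp_pos (2 * P * 0)]

/-- Grönwall's inequality on a time scale, with a vanishing free term. -/
theorem nonpos_of_le_prim {d : ℝ → ℝ} (hd : Continuous d) {P R : ℝ} (hP : 0 < P)
    (h : ∀ t ∈ S, t ≤ R → d t ≤ prim S (fun s => P * max (d s) 0) t) {t : ℝ} (ht : t ∈ S)
    (htR : t ≤ R) : d t ≤ 0 := by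
  obtain ⟨x, hx, hmax⟩ := ((isCompact_Icc (a := 0) (b := R)).inter_left hS.closed).exists_isMaxOn
    (f := fun s => max (d s) 0 * Real.exp (-(2 * P * s))) ⟨t, ht, hS.nonneg t ht, htR⟩
    (by fun_prop)
  set m := max (d x) 0 * Real.exp (-(2 * P * x)) with hm
  have hm0 : 0 ≤ m := by positivity
  have hle : ∀ s ∈ S, s ≤ R → max (d s) 0 ≤ m * Real.exp (2 * P * s) := fun s hs hsR => by
    have : max (d s) 0 * Real.exp (-(2 * P * s)) ≤ m := hmax ⟨hs, hS.nonneg s hs, hsR⟩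
    rwa [Real.exp_neg, ← div_eq_mul_inv, div_le_iff₀ (Real.exp_pos _)] at this
  have hxm : max (d x) 0 = m * Real.exp (2 * P * x) := by
    rw [hm, mul_assoc, ← Real.exp_add]; simp
  have hdx : d x ≤ m * (Real.exp (2 * P * x) / 2) := by
    calc d x ≤ prim S (fun s => P * max (d s) 0) x := h x hx.1 hx.2.2
      _ ≤ prim S (fun s => m * (P * Real.exp (2 * P * s))) x :=
          hS.prim_mono (by fun_prop) (by fun_prop) hx.1 fun s hs hsx => by
            have := hle s (kappa_subset hs) (hsx.trans hx.2.2)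
            nlinarith
      _ ≤ m * (Real.exp (2 * P * x) / 2) := by
          rw [prim_const_mul]
          exact mul_le_mul_of_nonneg_left (hS.prim_exp_le hP hx.2.1) hm0
  have hm_zero : m = 0 := by
    have : m * Real.exp (2 * P * x) ≤ m * (Real.exp (2 * P * x) / 2) := by
      rw [← hxm]; exact max_le hdx (by positivity)
    nlinarith [Real.exp_pos (2 * P * x)]
  have := hle t ht htR
  rw [hm_zero, zero_mul] at this
  exact (le_max_left _ _).trans this

theorem continuous_picardTerm {p : ℝ → ℝ → ℝ} (hp : Continuous fun z : ℝ × ℝ => p z.1 z.2)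
    (n : ℕ) : Continuous fun z : ℝ × ℝ => picardTerm S p n z.1 z.2 := by
  induction n with
  | zero => exact continuous_const
  | succ n ih => exact hS.continuous_prim (f := fun y s => p y s * picardTerm S p n y s) (hp.mul ih)

theorem exists_abs_picardTerm_le {p : ℝ → ℝ → ℝ} (hp : Continuous fun z : ℝ × ℝ => p z.1 z.2)
    (R : ℝ) : ∃ P > 0, (∀ y ∈ Icc (-R) R, ∀ t ∈ Icc 0 R, |p y t| ≤ P) ∧
      ∀ y ∈ Icc (-R) R, ∀ n, ∀ t ∈ Icc 0 R,
        |picardTerm S p n y t| ≤ (1 / 2) ^ n * Real.exp (2 * P * t) := by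
  obtain ⟨C, hC⟩ := ((isCompact_Icc (a := -R) (b := R)).prod
    (isCompact_Icc (a := 0) (b := R))).exists_bound_of_continuousOn hp.continuousOn
  have hCP : ∀ y ∈ Icc (-R) R, ∀ t ∈ Icc 0 R, |p y t| ≤ |C| + 1 := fun y hy t ht =>
    (hC (y, t) ⟨hy, ht⟩).trans (by linarith [le_abs_self C])
  have hP : 0 < |C| + 1 := by positivity
  refine ⟨|C| + 1, hP, hCP, fun y hy n => ?_⟩
  set P := |C| + 1
  induction n with
  | zero =>
    intro t ht
    have := ht.1
    simp only [picardTerm, abs_one, pow_zero, one_mul]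
    exact Real.one_le_exp (by positivity)
  | succ n ih =>
    intro t ht
    calc |picardTerm S p (n + 1) y t|
        ≤ prim S (fun s => (1 / 2) ^ n * (P * Real.exp (2 * P * s))) t :=
          hS.abs_prim_le (by fun_prop) ht.1 fun s hs hst => by
            have hs' : s ∈ Icc 0 R := ⟨hS.nonneg s hs, hst.trans ht.2⟩
            rw [abs_mul]
            calc _ ≤ P * ((1 / 2) ^ n * Real.exp (2 * P * s)) :=
                  mul_le_mul (hCP y hy s hs') (ih s hs') (abs_nonneg _) hP.le
              _ = _ := by ring
      _ ≤ (1 / 2) ^ n * (Real.exp (2 * P * t) / 2) := by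
          rw [prim_const_mul]
          exact mul_le_mul_of_nonneg_left (hS.prim_exp_le hP ht.1) (by positivity)
      _ = _ := by rw [pow_succ]; ring

/-- The integral equation of the exponential function of `p(y, ·)` has a solution that depends
continuously on the parameter `y` as well. -/
theorem exists_exp {p : ℝ → ℝ → ℝ} (hp : Continuous fun z : ℝ × ℝ => p z.1 z.2) :
    ∃ E : ℝ → ℝ → ℝ, (Continuous fun z : ℝ × ℝ => E z.1 z.2) ∧
      ∀ y, ∀ t ∈ S, E y t = 1 + prim S (fun s => p y s * E y s) t := by
  -- the bounds on the terms hold for `t ≥ 0` only, hence the truncation `max t 0`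
  refine ⟨fun y t => ∑' n, picardTerm S p n y (max t 0), ?_, ?_⟩
  · refine continuous_iff_continuousAt.2 fun ⟨y, t⟩ => ?_
    set R := |y| + |t| + 1
    obtain ⟨P, hP, -, hb⟩ := hS.exists_abs_picardTerm_le hp R
    have hon : ContinuousOn (fun z : ℝ × ℝ => ∑' n, picardTerm S p n z.1 (max z.2 0))
        (Icc (-R) R ×ˢ Icc (-R) R) := by
      refine continuousOn_tsum (u := fun n => (1 / 2 : ℝ) ^ n * Real.exp (2 * P * R)) (fun n => ?_)
        (summable_geometric_two.mul_right _) fun n z hz => ?_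
      · exact ((hS.continuous_picardTerm hp n).comp
          (by fun_prop : Continuous fun z : ℝ × ℝ => (z.1, max z.2 0))).continuousOn
      · have hR : 0 ≤ R := by positivity
        have hmR : max z.2 0 ≤ R := max_le hz.2.2 hR
        refine (hb z.1 hz.1 n _ ⟨le_max_right _ _, hmR⟩).trans ?_
        gcongr
    refine hon.continuousAt (prod_mem_nhds (Icc_mem_nhds ?_ ?_) (Icc_mem_nhds ?_ ?_)) <;>
    linarith [abs_nonneg y, abs_nonneg t, le_abs_self y, le_abs_self t, neg_abs_le y, neg_abs_le t]
  · intro y t ht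
    set R := |y| + |t| + 1
    obtain ⟨P, hP, hpP, hb⟩ := hS.exists_abs_picardTerm_le hp R
    have ht0 := hS.nonneg t ht
    have hyR : y ∈ Icc (-R) R := by
      constructor <;> linarith [abs_nonneg y, abs_nonneg t, le_abs_self y, neg_abs_le y]
    have htR : t ≤ R := by linarith [abs_nonneg y, le_abs_self t]
    have hsum : ∀ s ∈ Icc 0 R, Summable fun n => picardTerm S p n y s := fun s hs =>
      Summable.of_norm_bounded (summable_geometric_two.mul_right _) fun n => hb y hyR n s hs
    have hpy : Continuous (p y) := hp.comp (by fun_prop : Continuous fun s : ℝ => (y, s))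
    have hint : HasSum (fun n => picardTerm S p (n + 1) y t)
        (prim S (fun s => p y s * ∑' n, picardTerm S p n y (max s 0)) t) := by
      refine hasSum_integral_of_dominated_convergence
        (fun n _ => P * ((1 / 2 : ℝ) ^ n * Real.exp (2 * P * R))) (fun n => ?_)
        (fun n => Eventually.of_forall fun s hs => ?_) (Eventually.of_forall fun s _ => ?_)
        intervalIntegrable_const (Eventually.of_forall fun s hs => ?_)
      · exact (hS.measurable_comp (hpy.mul ((hS.continuous_picardTerm hp n).comp
          (by fun_prop : Continuous fun s : ℝ => (y, s))))).aestronglyMeasurable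
      · rw [uIoc_of_le ht0] at hs
        have hs' : floorMap S s ∈ Icc 0 R :=
          ⟨hS.floorMap_nonneg s, (hS.floorMap_le hs.1.le).trans (hs.2.trans htR)⟩
        rw [Real.norm_eq_abs, abs_mul]
        refine mul_le_mul (hpP y hyR _ hs') ((hb y hyR n _ hs').trans ?_) (abs_nonneg _) hP.le
        have := hs'.2
        gcongr
      · exact (summable_geometric_two.mul_right _).mul_left _
      · rw [uIoc_of_le ht0] at hs
        have hs' : floorMap S s ∈ Icc 0 R :=
          ⟨hS.floorMap_nonneg s, (hS.floorMap_le hs.1.le).trans (hs.2.trans htR)⟩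
        beta_reduce
        rw [max_eq_left hs'.1]
        exact (hsum _ hs').hasSum.mul_left _
    beta_reduce
    rw [max_eq_left ht0, (hsum t ⟨ht0, htR⟩).tsum_eq_zero_add, hint.tsum_eq]
    rfl

theorem deltaExp_eq {f p E : ℝ → ℝ} (hp : Continuous p) (hE : Continuous E)
    (hfp : ∀ t ∈ kappa S, f t = p t) (hEp : ∀ t ∈ S, E t = 1 + prim S (fun s => p s * E s) t)
    {t : ℝ} (ht : t ∈ S) : deltaExp S f t 0 = E t := by
  have hpE : Continuous fun s => p s * E s := by fun_prop
  have hex : ∃ x, IsExpSolution S f 0 x := by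
    refine ⟨fun t => 1 + prim S (fun s => p s * E s) t, by simp, fun t ht => ?_⟩
    have hd := hS.hasDeltaDerivAt_prim hpE (kappa_subset ht)
    dsimp only at hd ⊢
    rw [← hEp t (kappa_subset ht), hfp t ht]
    intro ε hε
    obtain ⟨δ, hδ, h⟩ := hd ε hε
    refine ⟨δ, hδ, fun s hs => ?_⟩
    rw [add_sub_add_left_eq_sub]
    exact h s hs
  rw [deltaExp, dif_pos hex]
  obtain ⟨hx0, hx⟩ := hex.choose_spec
  set x := hex.choose
  have hxc := hS.continuousOn_of_hasDeltaDerivAt (g := fun t => f t * x t) hx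
  obtain ⟨y, hy, hxy⟩ := exists_continuous_eq hS.closed hxc
  have hpy : Continuous fun s => p s * y s := by fun_prop
  have hyp : ∀ s ∈ S, y s = 1 + prim S (fun s => p s * y s) s := fun s hs => by
    rw [← hxy s hs, hS.eq_add_prim (F := x) hxc hpy (fun r hr => ?_) hs, hx0]
    rw [← hxy r (kappa_subset hr), ← hfp r hr]
    exact hx r hr
  obtain ⟨C, hC⟩ := (isCompact_Icc (a := 0) (b := t)).exists_bound_of_continuousOn hp.continuousOn
  have hdiff := hS.nonpos_of_le_prim (d := fun s => |y s - E s|) (P := |C| + 1) (R := t)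
    (by fun_prop) (by positivity) (fun s hs hst => ?_) ht le_rfl
  · rw [hxy t ht]
    exact sub_eq_zero.1 (abs_nonpos_iff.1 hdiff)
  · have heq : y s - E s = prim S (fun s => p s * (y s - E s)) s := by
      rw [hyp s hs, hEp s hs, add_sub_add_left_eq_sub, ← hS.prim_sub hpy hpE]
      simp only [mul_sub]
    rw [heq]
    refine hS.abs_prim_le (by fun_prop) (hS.nonneg s hs) fun r hr hrs => ?_
    rw [abs_mul, max_eq_left (abs_nonneg _)]
    refine mul_le_mul_of_nonneg_right ?_ (abs_nonneg _)
    exact (hC r ⟨hS.nonneg r hr, hrs.trans hst⟩).trans (by linarith [le_abs_self C])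

/-- The comparison theorem: a solution of `v^Δ ≤ p v` with `p ≥ 0` and `v(0) = k` is at most
`k` times the exponential function of `p`. -/
theorem le_mul_exp {v p E G : ℝ → ℝ} {k : ℝ} (hv : Continuous v) (hp : Continuous p)
    (hE : Continuous E) (hG : Continuous G)
    (hEp : ∀ t ∈ S, E t = 1 + prim S (fun s => p s * E s) t)
    (hvG : ∀ t ∈ S, v t = k + prim S G t) (hGp : ∀ t ∈ kappa S, G t ≤ p t * v t)
    (hp0 : ∀ t ∈ kappa S, 0 ≤ p t) {t : ℝ} (ht : t ∈ S) : v t ≤ k * E t := by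
  obtain ⟨C, hC⟩ := (isCompact_Icc (a := 0) (b := t)).exists_bound_of_continuousOn hp.continuousOn
  have hpE : Continuous fun s => p s * E s := by fun_prop
  refine sub_nonpos.1 (hS.nonpos_of_le_prim (d := fun s => v s - k * E s) (P := |C| + 1) (R := t)
    (by fun_prop) (by positivity) (fun s hs hst => ?_) ht le_rfl)
  have heq : v s - k * E s = prim S (fun r => G r - k * (p r * E r)) s := by
    rw [hS.prim_sub hG (by fun_prop), prim_const_mul, hvG s hs, hEp s hs]
    ring
  rw [heq]
  refine hS.prim_mono (by fun_prop) (by fun_prop) hs fun r hr hrs => ?_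
  have h1 : p r ≤ |C| + 1 := (le_abs_self _).trans
    ((hC r ⟨hS.nonneg r (kappa_subset hr), hrs.trans hst⟩).trans (by linarith [le_abs_self C]))
  calc G r - k * (p r * E r) ≤ p r * (v r - k * E r) := by linarith [hGp r hr]
    _ ≤ p r * max (v r - k * E r) 0 := mul_le_mul_of_nonneg_left (le_max_left _ _) (hp0 r hr)
    _ ≤ _ := mul_le_mul_of_nonneg_right h1 (le_max_right _ _)

end IsHalfScale

/-! ### The integral inequality in two variables -/

section

variable {S₁ S₂ : Set ℝ} (h₁ : IsHalfScale S₁) (h₂ : IsHalfScale S₂)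
include h₁ h₂

/-- The Wendroff-type inequality for globally continuous data. Here `W` plays the role of the
mixed derivative of `u`, so that `u = prim₂ S₁ S₂ W`, and `a₀ + prim S₁ a'` that of `a`. -/
theorem IsHalfScale.prim₂_le_of_le_add_prim₂ {W C P E : ℝ → ℝ → ℝ} {a' b : ℝ → ℝ} {a₀ : ℝ}
    (hW : Continuous fun z : ℝ × ℝ => W z.1 z.2) (hC : Continuous fun z : ℝ × ℝ => C z.1 z.2)
    (hP : Continuous fun z : ℝ × ℝ => P z.1 z.2) (hE : Continuous fun z : ℝ × ℝ => E z.1 z.2)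
    (ha' : Continuous a') (hb : Continuous b)
    (hW0 : ∀ s₁ ∈ kappa S₁, ∀ s₂ ∈ kappa S₂, 0 ≤ W s₁ s₂)
    (hC0 : ∀ s₁ ∈ kappa S₁, ∀ s₂ ∈ kappa S₂, 0 ≤ C s₁ s₂)
    (ha'0 : ∀ s ∈ kappa S₁, 0 ≤ a' s) (hbm : MonotoneOn b S₂)
    (hab : ∀ s ∈ S₁, 0 < a₀ + prim S₁ a' s + b 0)
    (hP1 : ∀ s₁ ∈ kappa S₁, ∀ s₂ ∈ S₂, P s₁ s₂ =
      a' s₁ / (a₀ + prim S₁ a' s₁ + b 0) + prim S₂ (fun s => 1 + C s₁ s) s₂)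
    (hE1 : ∀ s₂ ∈ S₂, ∀ s₁ ∈ S₁, E s₂ s₁ = 1 + prim S₁ (fun s => P s s₂ * E s₂ s) s₁)
    (hle : ∀ s₁ ∈ kappa S₁, ∀ s₂ ∈ kappa S₂, W s₁ s₂ ≤ a₀ + prim S₁ a' s₁ + b s₂ +
      prim₂ S₁ S₂ (fun r₁ r₂ => C r₁ r₂ * (prim₂ S₁ S₂ W r₁ r₂ + W r₁ r₂)) s₁ s₂)
    {t₁ t₂ : ℝ} (ht₁ : t₁ ∈ S₁) (ht₂ : t₂ ∈ S₂) :
    prim₂ S₁ S₂ W t₁ t₂ ≤ prim₂ S₁ S₂ (fun s₁ s₂ => a₀ + prim S₁ a' s₁ + b s₂ +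
      prim₂ S₁ S₂ (fun r₁ r₂ => (a₀ + b r₂) * E r₂ r₁ * C r₁ r₂) s₁ s₂) t₁ t₂ := by
  have hpair : ∀ s : ℝ, Continuous fun r : ℝ => (s, r) := fun s => by fun_prop
  have hpair' : ∀ s : ℝ, Continuous fun r : ℝ => (r, s) := fun s => by fun_prop
  set U := prim₂ S₁ S₂ W with hU
  have hUc : Continuous fun z : ℝ × ℝ => U z.1 z.2 := h₁.continuous_prim₂ h₂ hW
  have hac : Continuous (prim S₁ a') := h₁.continuous_prim' ha'
  set g : ℝ → ℝ → ℝ := fun s₁ s₂ => C s₁ s₂ * (U s₁ s₂ + W s₁ s₂) with hg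
  have hgc : Continuous fun z : ℝ × ℝ => g z.1 z.2 := hC.mul (hUc.add hW)
  have hG2c : Continuous fun z : ℝ × ℝ => prim₂ S₁ S₂ g z.1 z.2 := h₁.continuous_prim₂ h₂ hgc
  set z : ℝ → ℝ → ℝ := fun s₁ s₂ => a₀ + prim S₁ a' s₁ + b s₂ + prim₂ S₁ S₂ g s₁ s₂ with hz
  have hzc : Continuous fun w : ℝ × ℝ => z w.1 w.2 :=
    ((continuous_const.add (hac.comp continuous_fst)).add (hb.comp continuous_snd)).add hG2c
  set Z := prim₂ S₁ S₂ z with hZ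
  have hZc : Continuous fun w : ℝ × ℝ => Z w.1 w.2 := h₁.continuous_prim₂ h₂ hzc
  set v : ℝ → ℝ → ℝ := fun s₁ s₂ => z s₁ s₂ + Z s₁ s₂ with hv
  have hvc : Continuous fun w : ℝ × ℝ => v w.1 w.2 := hzc.add hZc
  have hU0 : ∀ s₁ ∈ S₁, ∀ s₂ ∈ S₂, 0 ≤ U s₁ s₂ := fun s₁ hs₁ s₂ hs₂ =>
    h₁.prim₂_nonneg h₂ hW hW0 hs₁ hs₂
  have hg0 : ∀ s₁ ∈ kappa S₁, ∀ s₂ ∈ kappa S₂, 0 ≤ g s₁ s₂ := fun s₁ hs₁ s₂ hs₂ =>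
    mul_nonneg (hC0 _ hs₁ _ hs₂)
      (add_nonneg (hU0 _ (kappa_subset hs₁) _ (kappa_subset hs₂)) (hW0 _ hs₁ _ hs₂))
  have hz0 : ∀ s₁ ∈ kappa S₁, ∀ s₂ ∈ kappa S₂, 0 ≤ z s₁ s₂ := fun s₁ hs₁ s₂ hs₂ =>
    (hW0 _ hs₁ _ hs₂).trans (hle _ hs₁ _ hs₂)
  have hZ0 : ∀ s₁ ∈ S₁, ∀ s₂ ∈ S₂, 0 ≤ Z s₁ s₂ := fun s₁ hs₁ s₂ hs₂ =>
    h₁.prim₂_nonneg h₂ hzc hz0 hs₁ hs₂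
  have hUZ : ∀ s₁ ∈ S₁, ∀ s₂ ∈ S₂, U s₁ s₂ ≤ Z s₁ s₂ := fun s₁ hs₁ s₂ hs₂ =>
    h₁.prim₂_mono h₂ hW hzc hle hs₁ hs₂
  have hgv : ∀ s₁ ∈ kappa S₁, ∀ s₂ ∈ kappa S₂, g s₁ s₂ ≤ C s₁ s₂ * v s₁ s₂ :=
    fun s₁ hs₁ s₂ hs₂ => by
      have := hUZ _ (kappa_subset hs₁) _ (kappa_subset hs₂)
      have := hle _ hs₁ _ hs₂
      refine mul_le_mul_of_nonneg_left ?_ (hC0 _ hs₁ _ hs₂)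
      simp only [hv]
      linarith
  have hvmono : ∀ s₁ ∈ S₁, ∀ s₂ ∈ S₂, ∀ r₂ ∈ S₂, s₂ ≤ r₂ → v s₁ s₂ ≤ v s₁ r₂ :=
    fun s₁ hs₁ s₂ hs₂ r₂ hr₂ hsr => by
      have i1 := hbm hs₂ hr₂ hsr
      have i2 := h₁.prim₂_le_prim₂ h₂ hgc hg0 hs₁ hs₂ hr₂ hsr
      have i3 := h₁.prim₂_le_prim₂ h₂ hzc hz0 hs₁ hs₂ hr₂ hsr
      simp only [hv, hz, hZ] at i3 ⊢
      linarith
  have hvge : ∀ s₁ ∈ S₁, ∀ s₂ ∈ S₂, a₀ + prim S₁ a' s₁ + b 0 ≤ v s₁ s₂ :=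
    fun s₁ hs₁ s₂ hs₂ => by
      have i1 := hbm h₂.zero_mem hs₂ (h₂.nonneg _ hs₂)
      have i2 := h₁.prim₂_nonneg h₂ hgc hg0 hs₁ hs₂
      have i3 := hZ0 _ hs₁ _ hs₂
      simp only [hv, hz]
      linarith
  have hP0 : ∀ s₁ ∈ kappa S₁, ∀ s₂ ∈ S₂, 0 ≤ P s₁ s₂ := fun s₁ hs₁ s₂ hs₂ => by
    rw [hP1 _ hs₁ _ hs₂]
    refine add_nonneg (div_nonneg (ha'0 _ hs₁) (hab _ (kappa_subset hs₁)).le) ?_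
    exact h₂.prim_nonneg (f := fun s => 1 + C s₁ s) (continuous_const.add (hC.comp (hpair s₁)))
      hs₂ fun s hs => by
      linarith [hC0 _ hs₁ _ hs]
  have hvE : ∀ s₁ ∈ S₁, ∀ s₂ ∈ S₂, v s₁ s₂ ≤ (a₀ + b s₂) * E s₂ s₁ := by
    intro s₁ hs₁ s₂ hs₂
    -- the delta derivative of `v` in the first variable
    have hG₁ : Continuous fun s => prim S₂ (g s) s₂ := (h₂.continuous_prim hgc).comp (hpair' s₂)
    have hG₂ : Continuous fun s => prim S₂ (z s) s₂ := (h₂.continuous_prim hzc).comp (hpair' s₂)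
    refine h₁.le_mul_exp (v := fun s => v s s₂) (p := fun s => P s s₂) (E := E s₂)
      (G := fun s => a' s + prim S₂ (g s) s₂ + prim S₂ (z s) s₂) (hvc.comp (hpair' s₂))
      (hP.comp (hpair' s₂)) (hE.comp (hpair s₂)) ((ha'.add hG₁).add hG₂) (hE1 s₂ hs₂)
      (fun s _ => ?_) (fun s hs => ?_) (fun s hs => hP0 s hs s₂ hs₂) hs₁
    · rw [h₁.prim_add (f := fun s => a' s + prim S₂ (g s) s₂) (ha'.add hG₁) hG₂,
        h₁.prim_add ha' hG₁]
      simp only [hv, hz, hZ, prim₂]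
      ring
    · have hsS := kappa_subset hs
      have i1 : a' s ≤ a' s / (a₀ + prim S₁ a' s + b 0) * v s s₂ := by
        rw [div_mul_eq_mul_div, le_div_iff₀ (hab s hsS)]
        exact mul_le_mul_of_nonneg_left (hvge s hsS s₂ hs₂) (ha'0 s hs)
      have i2 : prim S₂ (g s) s₂ + prim S₂ (z s) s₂
          ≤ v s s₂ * prim S₂ (fun r => 1 + C s r) s₂ := by
        have hgs : Continuous (g s) := hgc.comp (hpair s)
        have hzs : Continuous (z s) := hzc.comp (hpair s)
        have hCs : Continuous (C s) := hC.comp (hpair s)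
        rw [← h₂.prim_add hgs hzs, ← prim_const_mul]
        refine h₂.prim_mono (f := fun r => g s r + z s r) (hgs.add hzs) (by fun_prop) hs₂
          fun r hr hrs => ?_
        have hrS := kappa_subset hr
        have j1 := hgv s hs r hr
        have j2 : z s r ≤ v s r := le_add_of_nonneg_right (hZ0 s hsS r hrS)
        have j3 := hvmono s hsS r hrS s₂ hs₂ hrs
        have j4 := mul_le_mul_of_nonneg_left j3 (hC0 s hs r hr)
        linarith
      rw [hP1 s hs s₂ hs₂, add_mul]
      linarith
  refine (hUZ _ ht₁ _ ht₂).trans ?_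
  have hqc : Continuous fun w : ℝ × ℝ => (a₀ + b w.2) * E w.2 w.1 * C w.1 w.2 :=
    ((continuous_const.add (hb.comp continuous_snd)).mul (hE.comp continuous_swap)).mul hC
  refine h₁.prim₂_mono h₂ hzc
    (((continuous_const.add (hac.comp continuous_fst)).add (hb.comp continuous_snd)).add
      (h₁.continuous_prim₂ h₂ (f := fun r₁ r₂ => (a₀ + b r₂) * E r₂ r₁ * C r₁ r₂) hqc))
    (fun s₁ hs₁ s₂ hs₂ => add_le_add le_rfl ?_) ht₁ ht₂
  refine h₁.prim₂_mono h₂ hgc hqc (fun r₁ hr₁ r₂ hr₂ => (hgv _ hr₁ _ hr₂).trans ?_)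
    (kappa_subset hs₁) (kappa_subset hs₂)
  rw [mul_comm]
  exact mul_le_mul_of_nonneg_right (hvE _ (kappa_subset hr₁) _ (kappa_subset hr₂))
    (hC0 _ hr₁ _ hr₂)

/-! ### Functions of class `C¹` and `C²` as delta primitives -/

/-- A function of class `C²` that vanishes on the axes is the iterated integral of its mixed
derivative. -/
theorem IsHalfScale.eq_prim₂_partialDelta₁₂ {u W : ℝ → ℝ → ℝ} (hu : IsC2Two S₁ S₂ u)
    (hu_left : ∀ t₂ ∈ S₂, u 0 t₂ = 0) (hu_bot : ∀ t₁ ∈ S₁, u t₁ 0 = 0)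
    (hW : Continuous fun z : ℝ × ℝ => W z.1 z.2)
    (huW : ∀ s₁ ∈ kappa S₁, ∀ s₂ ∈ kappa S₂, partialDelta₁₂ S₁ S₂ u s₁ s₂ = W s₁ s₂)
    {t₁ t₂ : ℝ} (ht₁ : t₁ ∈ S₁) (ht₂ : t₂ ∈ S₂) : u t₁ t₂ = prim₂ S₁ S₂ W t₁ t₂ := by
  obtain ⟨⟨huc, hd₁, hc₁, -, -⟩, ⟨-, -, -, hd₁₂, -⟩, -⟩ := hu
  have hbot : ∀ s ∈ kappa S₁, partialDelta₁ S₁ u s 0 = 0 := fun s hs =>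
    h₁.eq_zero_of_hasDeltaDerivAt hs (hd₁ s hs 0 h₂.zero_mem).hasDeltaDerivAt hu_bot
  have hpart : ∀ s ∈ kappa S₁, partialDelta₁ S₁ u s t₂ = prim S₂ (W s) t₂ := fun s hs => by
    have := h₂.eq_add_prim (F := partialDelta₁ S₁ u s) (g := W s)
      (hc₁.comp (by fun_prop : ContinuousOn (fun r : ℝ => (s, r)) S₂) fun r hr => ⟨hs, hr⟩)
      (hW.comp (by fun_prop : Continuous fun r : ℝ => (s, r)))
      (fun r hr => huW s hs r hr ▸ (hd₁₂ s hs r hr).hasDeltaDerivAt) ht₂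
    rwa [hbot s hs, zero_add] at this
  have := h₁.eq_add_prim (F := fun s => u s t₂) (g := fun s => prim S₂ (W s) t₂)
    (huc.comp (by fun_prop : ContinuousOn (fun r : ℝ => (r, t₂)) S₁) fun r hr => ⟨hr, ht₂⟩)
    ((h₂.continuous_prim hW).comp (by fun_prop : Continuous fun s : ℝ => (s, t₂)))
    (fun s hs => hpart s hs ▸ (hd₁ s hs t₂ ht₂).hasDeltaDerivAt) ht₁
  rwa [hu_left t₂ ht₂, zero_add] at this

end

theorem isHalfScale_nonnegPart {T : Set ℝ} (hT : IsTimeScale T) (h0 : (0 : ℝ) ∈ T)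
    (hpos : ∃ t ∈ T, 0 < t) : IsHalfScale (nonnegPart T) where
  closed := isClosed_Ici.inter hT.2
  zero_mem := ⟨le_refl (0 : ℝ), h0⟩
  nonneg _ ht := ht.1
  exists_pos := hpos.imp fun _ ht => ⟨⟨ht.2.le, ht.1⟩, ht.2⟩

/-- A function of class `C¹` is a primitive of a continuous extension of its delta derivative. -/
theorem IsHalfScale.exists_eq_add_prim {S : Set ℝ} (hS : IsHalfScale S) {f : ℝ → ℝ}
    (hf : IsC1 S f) : ∃ g : ℝ → ℝ, Continuous g ∧ (∀ t ∈ kappa S, deltaDeriv S f t = g t) ∧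
      ∀ t ∈ S, f t = f 0 + prim S g t := by
  obtain ⟨g, hg, hfg⟩ := exists_continuous_eq hS.isClosed_kappa hf.2.2
  exact ⟨g, hg, hfg, fun t ht => hS.eq_add_prim hf.1 hg
    (fun s hs => hfg s hs ▸ (hf.2.1 s hs).hasDeltaDerivAt) ht⟩

end

end TimeScale

open TimeScale in
theorem theorem6p7 (T₁ T₂ S₁ S₂ : Set ℝ)
    (hT₁ : TimeScale.IsTimeScale T₁) (hT₂ : TimeScale.IsTimeScale T₂)
    (h0₁ : (0 : ℝ) ∈ T₁) (h0₂ : (0 : ℝ) ∈ T₂)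
    (hpos₁ : ∃ t ∈ T₁, 0 < t) (hpos₂ : ∃ t ∈ T₂, 0 < t)
    -- the domain is `S₁ × S₂ = (ℝ₊ ∩ T₁) × (ℝ₊ ∩ T₂)`
    (hS₁ : S₁ = TimeScale.nonnegPart T₁) (hS₂ : S₂ = TimeScale.nonnegPart T₂)
    (u c : ℝ → ℝ → ℝ) (a b : ℝ → ℝ)
    (hu : TimeScale.IsC2Two S₁ S₂ u)
    (hu_nonneg : ∀ t₁ ∈ TimeScale.kappa S₁, ∀ t₂ ∈ TimeScale.kappa S₂,
      0 ≤ TimeScale.partialDelta₁₂ S₁ S₂ u t₁ t₂)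
    (hc : TimeScale.IsC0Two S₁ S₂ c)
    (hc_nonneg : ∀ t₁ ∈ S₁, ∀ t₂ ∈ S₂, 0 ≤ c t₁ t₂)
    (hu_left : ∀ t₂ ∈ S₂, u 0 t₂ = 0) (hu_bot : ∀ t₁ ∈ S₁, u t₁ 0 = 0)
    (ha : TimeScale.IsC1 S₁ a) (hb : TimeScale.IsC1 S₂ b)
    (ha_pos : ∀ t₁ ∈ S₁, 0 < a t₁) (hb_pos : ∀ t₂ ∈ S₂, 0 < b t₂)
    (ha_deriv : ∀ t₁ ∈ TimeScale.kappa S₁, 0 ≤ TimeScale.deltaDeriv S₁ a t₁)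
    (hb_deriv : ∀ t₂ ∈ TimeScale.kappa S₂, 0 ≤ TimeScale.deltaDeriv S₂ b t₂)
    (hineq : ∀ t₁ ∈ TimeScale.kappa S₁, ∀ t₂ ∈ TimeScale.kappa S₂,
      TimeScale.partialDelta₁₂ S₁ S₂ u t₁ t₂ ≤ a t₁ + b t₂ +
        TimeScale.deltaIntegral₂ S₁ S₂
          (fun s₁ s₂ => c s₁ s₂ * (u s₁ s₂ + TimeScale.partialDelta₁₂ S₁ S₂ u s₁ s₂)) t₁ t₂)
    (p q h : ℝ → ℝ → ℝ)
    (hp : ∀ t₁ ∈ TimeScale.kappa S₁, ∀ t₂ ∈ S₂,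
      p t₁ t₂ = TimeScale.deltaDeriv S₁ a t₁ / (a t₁ + b 0) +
        TimeScale.deltaIntegral S₂ (fun s₂ => 1 + c t₁ s₂) 0 t₂)
    (hq : ∀ t₁ ∈ S₁, ∀ t₂ ∈ S₂,
      q t₁ t₂ = (a 0 + b t₂) * TimeScale.deltaExp S₁ (fun s₁ => p s₁ t₂) t₁ 0 * c t₁ t₂)
    (hh : ∀ t₁ ∈ S₁, ∀ t₂ ∈ S₂,
      h t₁ t₂ = a t₁ + b t₂ + TimeScale.deltaIntegral₂ S₁ S₂ q t₁ t₂) :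
    ∀ t₁ ∈ S₁, ∀ t₂ ∈ S₂, u t₁ t₂ ≤ TimeScale.deltaIntegral₂ S₁ S₂ h t₁ t₂ := by
  intro t₁ ht₁ t₂ ht₂
  have h₁ : IsHalfScale S₁ := hS₁ ▸ isHalfScale_nonnegPart hT₁ h0₁ hpos₁
  have h₂ : IsHalfScale S₂ := hS₂ ▸ isHalfScale_nonnegPart hT₂ h0₂ hpos₂
  have hk₁ : ∀ s ∈ kappa S₁, s ∈ S₁ := fun s hs => hs.1
  have hk₂ : ∀ s ∈ kappa S₂, s ∈ S₂ := fun s hs => hs.1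
  have hpair : ∀ s : ℝ, Continuous fun r : ℝ => (s, r) := fun s => by fun_prop
  have hpair' : ∀ s : ℝ, Continuous fun r : ℝ => (r, s) := fun s => by fun_prop
  -- continuous extensions of the data from the closed sets where they are given
  obtain ⟨W', hW, huW'⟩ := exists_continuous_eq (h₁.isClosed_kappa.prod h₂.isClosed_kappa)
    (show ContinuousOn (fun z : ℝ × ℝ => partialDelta₁₂ S₁ S₂ u z.1 z.2) _ from hu.2.1.2.2.2.2)
  obtain ⟨C', hC, hcC'⟩ := exists_continuous_eq (h₁.closed.prod h₂.closed) hc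
  set W : ℝ → ℝ → ℝ := fun s₁ s₂ => W' (s₁, s₂)
  set C : ℝ → ℝ → ℝ := fun s₁ s₂ => C' (s₁, s₂)
  have huW : ∀ s₁ ∈ kappa S₁, ∀ s₂ ∈ kappa S₂, partialDelta₁₂ S₁ S₂ u s₁ s₂ = W s₁ s₂ :=
    fun s₁ hs₁ s₂ hs₂ => huW' (s₁, s₂) ⟨hs₁, hs₂⟩
  have hcC : ∀ s₁ ∈ S₁, ∀ s₂ ∈ S₂, c s₁ s₂ = C s₁ s₂ := fun s₁ hs₁ s₂ hs₂ =>
    hcC' (s₁, s₂) ⟨hs₁, hs₂⟩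
  obtain ⟨a', ha'c, haa', haprim⟩ := h₁.exists_eq_add_prim ha
  obtain ⟨b', hb'c, hbb', hbprim⟩ := h₂.exists_eq_add_prim hb
  obtain ⟨Q, hQc, hQ⟩ := exists_continuous_eq h₁.isClosed_kappa
    (f := fun s => a' s / (a s + b 0)) (ha'c.continuousOn.div
      ((ha.1.mono hk₁).add continuousOn_const)
      fun s hs => (add_pos (ha_pos s (hk₁ s hs)) (hb_pos 0 h₂.zero_mem)).ne')
  have hC1 : Continuous fun z : ℝ × ℝ => 1 + C z.1 z.2 := continuous_const.add hC
  set P : ℝ → ℝ → ℝ := fun s₁ s₂ => Q s₁ + prim S₂ (fun s => 1 + C s₁ s) s₂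
  have hPc : Continuous fun z : ℝ × ℝ => P z.1 z.2 :=
    (hQc.comp continuous_fst).add
      (h₂.continuous_prim (f := fun s₁ s => 1 + C s₁ s) hC1)
  obtain ⟨E, hEc, hE⟩ := h₁.exists_exp (p := fun s₂ s₁ => P s₁ s₂) (hPc.comp continuous_swap)
  have hexp : ∀ s₁ ∈ S₁, ∀ s₂ ∈ S₂, deltaExp S₁ (fun s => p s s₂) s₁ 0 = E s₂ s₁ :=
    fun s₁ hs₁ s₂ hs₂ => h₁.deltaExp_eq (p := fun s => P s s₂) (hPc.comp (hpair' s₂))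
      (hEc.comp (hpair s₂)) (fun s hs => by
        rw [hp s hs s₂ hs₂, haa' s hs, hQ s hs,
          h₂.deltaIntegral_eq (g := fun r => 1 + C s r) (hC1.comp (hpair s))
            (fun r hr => by rw [hcC s (hk₁ s hs) r (hk₂ r hr)]) hs₂])
      (hE s₂) hs₁
  set B : ℝ → ℝ := fun s => b 0 + prim S₂ b' s
  have hBc : Continuous B := continuous_const.add (h₂.continuous_prim' hb'c)
  have hB0 : B 0 = b 0 := by simp [B]
  have hac : Continuous (prim S₁ a') := h₁.continuous_prim' ha'c
  have hUW : ∀ s₁ ∈ S₁, ∀ s₂ ∈ S₂, u s₁ s₂ = prim₂ S₁ S₂ W s₁ s₂ := fun s₁ hs₁ s₂ hs₂ =>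
    h₁.eq_prim₂_partialDelta₁₂ h₂ hu hu_left hu_bot hW huW hs₁ hs₂
  have hUc := h₁.continuous_prim₂ h₂ (f := W) hW
  have hqc : Continuous fun w : ℝ × ℝ => (a 0 + B w.2) * E w.2 w.1 * C w.1 w.2 :=
    ((continuous_const.add (hBc.comp continuous_snd)).mul (hEc.comp continuous_swap)).mul hC
  have hhint : deltaIntegral₂ S₁ S₂ h t₁ t₂ = prim₂ S₁ S₂ (fun s₁ s₂ =>
      a 0 + prim S₁ a' s₁ + B s₂ +
      prim₂ S₁ S₂ (fun r₁ r₂ => (a 0 + B r₂) * E r₂ r₁ * C r₁ r₂) s₁ s₂) t₁ t₂ := by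
    refine h₁.deltaIntegral₂_eq h₂
      (((continuous_const.add (hac.comp continuous_fst)).add (hBc.comp continuous_snd)).add
        (h₁.continuous_prim₂ h₂ (f := fun r₁ r₂ => (a 0 + B r₂) * E r₂ r₁ * C r₁ r₂) hqc))
      (fun s₁ hs₁ s₂ hs₂ => ?_) ht₁ ht₂
    rw [hh s₁ (hk₁ s₁ hs₁) s₂ (hk₂ s₂ hs₂), haprim s₁ (hk₁ s₁ hs₁), hbprim s₂ (hk₂ s₂ hs₂),
      h₁.deltaIntegral₂_eq h₂ (g := fun r₁ r₂ => (a 0 + B r₂) * E r₂ r₁ * C r₁ r₂) hqc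
        (fun r₁ hr₁ r₂ hr₂ => ?_) (hk₁ s₁ hs₁) (hk₂ s₂ hs₂)]
    rw [hq r₁ (hk₁ r₁ hr₁) r₂ (hk₂ r₂ hr₂), hexp r₁ (hk₁ r₁ hr₁) r₂ (hk₂ r₂ hr₂),
      hcC r₁ (hk₁ r₁ hr₁) r₂ (hk₂ r₂ hr₂), hbprim r₂ (hk₂ r₂ hr₂)]
  rw [hhint, hUW t₁ ht₁ t₂ ht₂]
  refine h₁.prim₂_le_of_le_add_prim₂ h₂ (P := P) hW hC hPc hEc ha'c hBc
    (fun s₁ hs₁ s₂ hs₂ => huW s₁ hs₁ s₂ hs₂ ▸ hu_nonneg s₁ hs₁ s₂ hs₂)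
    (fun s₁ hs₁ s₂ hs₂ => hcC s₁ (hk₁ s₁ hs₁) s₂ (hk₂ s₂ hs₂) ▸
      hc_nonneg s₁ (hk₁ s₁ hs₁) s₂ (hk₂ s₂ hs₂))
    (fun s hs => haa' s hs ▸ ha_deriv s hs)
    (fun r hr s hs hrs => add_le_add le_rfl (h₂.prim_le_prim hb'c hr hs hrs
      fun x hx => hbb' x hx ▸ hb_deriv x hx))
    (fun s hs => ?_) (fun s₁ hs₁ s₂ _ => ?_) (fun s₂ _ s₁ hs₁ => hE s₂ s₁ hs₁)
    (fun s₁ hs₁ s₂ hs₂ => ?_) ht₁ ht₂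
  · rw [← haprim s hs, hB0]
    exact add_pos (ha_pos s hs) (hb_pos 0 h₂.zero_mem)
  · rw [← haprim s₁ (hk₁ s₁ hs₁), hB0, hQ s₁ hs₁]
  · have := hineq s₁ hs₁ s₂ hs₂
    rwa [huW s₁ hs₁ s₂ hs₂, haprim s₁ (hk₁ s₁ hs₁), hbprim s₂ (hk₂ s₂ hs₂),
      h₁.deltaIntegral₂_eq h₂ (g := fun r₁ r₂ => C r₁ r₂ * (prim₂ S₁ S₂ W r₁ r₂ + W r₁ r₂))
        (hC.mul (hUc.add hW)) (fun r₁ hr₁ r₂ hr₂ => by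
          rw [hcC r₁ (hk₁ r₁ hr₁) r₂ (hk₂ r₂ hr₂), hUW r₁ (hk₁ r₁ hr₁) r₂ (hk₂ r₂ hr₂),
            huW r₁ hr₁ r₂ hr₂]) (hk₁ s₁ hs₁) (hk₂ s₂ hs₂)] at this
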